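/- **Setting.** Let $\mathcal A=(a_{ij})\in\mathbb R^{n\times n}$ be a symmetric stochastic matrix (nonnegative entries, row sums $1$), let $\mathscr G$ be the undirected graph on $\{1,\dots,n\}$ in which distinct $i,j$ are adjacent iff $a_{ij}>0$, let $N^i$ consist of $i$ and its neighbours, and let $\mathbf L=\mathbf I-\mathcal A$. Assume that $\mathscr G$ is connected, and let $Q$ be at least its diameter. Let $\theta\in\mathbb R^m$ ($m\ge1$), let $\varphi^i_k$ ($k\ge0$) be random vectors in $\mathbb R^m$, and let $\Xi_k=(\varepsilon^1_k,\dots,\varepsilon^n_k)$ ($k\ge1$) be random noise vectors, on a common probability space, with observations $y^i_{k+1}=\theta^T\varphi^i_k+\varepsilon^i_{k+1}$, $k\ge0$. Put $$r^i_k=1+\sum_{j=1}^k\|\varphi^i_j\|^2,\qquad x^i_k(0)=\frac{\|\varphi^i_k\|^2}{r^i_k},\qquad x^i_k(q+1)=\sum_{j\in N^i}a_{ij}x^j_k(q).$$ With step sizes $\mu,\nu\in(0,1)$ and arbitrary initial estimates $\hat\theta^i_0$, the distributed stochastic gradient algorithm is $$\hat\theta^i_{k+1}=\hat\theta^i_k+\mu\frac{\varphi^i_k}{r^i_k}\bigl(y^i_{k+1}-(\varphi^i_k)^T\hat\theta^i_k\bigr)-\mu\nu\sum_{j\in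 N^i}a_{ij}(z^i_k-z^j_k),\qquad z^i_k=x^i_k(Q)\sum_{l\in N^i}a_{li}(\hat\theta^i_k-\hat\theta^l_k).$$ Let $\Phi_k=\mathrm{diag}(\varphi^1_k,\dots,\varphi^n_k)\in\mathbb R^{mn\times n}$, $\mathbf R_k=\mathrm{diag}(r^1_k,\dots,r^n_k)$, $\mathbf A_k=\Phi_k\mathbf R_k^{-1}\Phi_k^T$, $\mathbf X_k=\mathrm{diag}(x^1_k(Q),\dots,x^n_k(Q))$, and $$\mathbf G_k=\mathbf A_k+\nu(\mathbf L\otimes \mathbf I_m)(\mathbf X_k\otimes \mathbf I_m)(\mathbf L\otimes \mathbf I_m),\quad \Psi(k+1,0)=(\mathbf I_{mn}-\mu \mathbf G_k)\Psi(k,0),\quad \Psi(0,0)=\mathbf I_{mn}.$$ Let $\hat\Theta_k$ be the column vector stacked from $\hat\theta^1_k,\dots,\hat\theta^n_k$, and let $\Theta$ be stacked from $n$ copies of $\theta$. Vectors carry the Euclidean norm and matrices the spectral norm. **Assumptions.** $\mu(1+4\nu)<1$. The condition number of $\mathbf R_k$ is bounded: almost surely there is $\gamma=\gamma(\omega)>0$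 with $\max_i r^i_k/\min_i r^i_k\le\gamma$ for all $k\ge0$. With $\mathscr F_k$ the $\sigma$-algebra generated by $\varphi^i_j$ ($0\le j\le k$) and $\varepsilon^i_j$ ($1\le j\le k$), $1\le i\le n$, the noise is a martingale difference sequence, that is, $\Xi_{k+1}$ is integrable with $E(\Xi_{k+1}\mid\mathscr F_k)=0$ for all $k\ge0$; and there are $c_0>0$ and $\varepsilon\in[0,1)$, which may depend on $\omega$, with $E(\|\Xi_{k+1}\|^2\mid\mathscr F_k)\le c_0\|\mathbf R_k\|^{\varepsilon}$ almost surely for all $k\ge0$. **Claim.** Call $\tau_1\ge1$ admissible if $\det(\mathbf I_{mn}-\mu\mathbf G_k)\ge[\det(\mathbf I_{mn}-\mathbf A_k)]^{\tau_1}$ for all $k\ge1$. Then $\tau_1=mn$ is always admissible. Moreover, for almost every $\omega$ for which $\mathbf I_{mn}-\mu\mathbf G_0$ is nonsingular (which holds for instance if $\|\varphi^i_0\|\le1$ for all $i$) and $\lim_{k\to\infty}\Psi(k,0)=0$, for every $\delta\in(0,\frac{1-\varepsilon}{2})$ and every admissible $\tau_1$ (in particular $\tau_1=mn$), $$\|\hat\Theta_k-\Theta\|=O\Bigl(\|\Psi(k,0)\|^{\frac{\delta}{n\tau_1(1+\delta)}}\Bigr),$$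 that is, there is $M=M(\omega)>0$ such that $\|\hat\Theta_k-\Theta\|\le M\|\Psi(k,0)\|^{\delta/(n\tau_1(1+\delta))}$ for all $k\ge0$. -/

import Mathlib

open MeasureTheory Filter Topology
-- matrix norms are spectral norms, i.e. the operator norms for the Euclidean norms
open scoped Matrix Kronecker Matrix.Norms.L2Operator

noncomputable section

namespace DistSG

/-- An undirected weighted graph on `n` sensors, given by its symmetric stochastic weight matrix. -/
structure Network (n : ℕ) where
  weight : Matrix (Fin n) (Fin n) ℝ
  nonneg : ∀ i j, 0 ≤ weight i j
  symm : weight.IsSymm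
  row_sum : ∀ i, ∑ j, weight i j = 1

namespace Network

variable {n : ℕ} (𝒩 : Network n)

/-- Two distinct sensors are joined by an edge iff the weight between them is positive. -/
def graph : SimpleGraph (Fin n) where
  Adj i j := i ≠ j ∧ 0 < 𝒩.weight i j
  symm := ⟨fun i j h => ⟨h.1.symm, by rw [𝒩.symm.apply]; exact h.2⟩⟩
  loopless := ⟨fun _ h => h.1 rfl⟩

open scoped Classical in
/-- The neighbours of a sensor, the sensor itself included. -/
def nbrs (i : Fin n) : Finset (Fin n) :=
  Finset.univ.filter fun j => j = i ∨ 𝒩.graph.Adj i j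

/-- The Laplacian matrix `L = I - 𝒜`. -/
def laplacian : Matrix (Fin n) (Fin n) ℝ := 1 - 𝒩.weight

end Network

section Path

/-! Everything in this section is for one realization `φ k i ∈ ℝᵐ` of the regressors. -/

variable {n m : ℕ} (𝒩 : Network n) (φ : ℕ → Fin n → EuclideanSpace ℝ (Fin m))

/-- `r^i_k = 1 + ∑_{j=1}^k ‖φ^i_j‖²`. -/
def r (k : ℕ) (i : Fin n) : ℝ := 1 + ∑ j ∈ Finset.Icc 1 k, ‖φ j i‖ ^ 2

/-- The diffusion `x^i_k(q)`. -/
def x (k : ℕ) : ℕ → Fin n → ℝ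
  | 0 => fun i => ‖φ k i‖ ^ 2 / r φ k i
  | q + 1 => fun i => ∑ j ∈ 𝒩.nbrs i, 𝒩.weight i j * x k q j

/-- `z^i_k = x^i_k(Q) ∑_{l ∈ N^i} a_{li} (θ^i - θ^l)`. -/
def z (Q k : ℕ) (est : Fin n → EuclideanSpace ℝ (Fin m)) (i : Fin n) :
    EuclideanSpace ℝ (Fin m) :=
  x 𝒩 φ k Q i • ∑ l ∈ 𝒩.nbrs i, 𝒩.weight l i • (est i - est l)

/-- The estimates `θ̂^i_k` of the distributed stochastic gradient algorithm, computed from the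
regressors `φ`, the observations `y` and the initial estimates `θ₀`. -/
def estimate (Q : ℕ) (μ ν : ℝ) (y : ℕ → Fin n → ℝ) (θ₀ : Fin n → EuclideanSpace ℝ (Fin m)) :
    ℕ → Fin n → EuclideanSpace ℝ (Fin m)
  | 0 => θ₀
  | k + 1 => fun i =>
      let est := estimate Q μ ν y θ₀ k
      est i + (μ * ((y (k + 1) i - inner ℝ (φ k i) (est i)) / r φ k i)) • φ k i
        - (μ * ν) • ∑ j ∈ 𝒩.nbrs i, 𝒩.weight i j • (z 𝒩 φ Q k est i - z 𝒩 φ Q k est j)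

/-- `Φ_k = diag(φ^1_k, …, φ^n_k)`, of size `mn × n`. -/
def Phi (k : ℕ) : Matrix (Fin n × Fin m) (Fin n) ℝ :=
  Matrix.of fun p j => if p.1 = j then φ k p.1 p.2 else 0

/-- `R_k = diag(r^1_k, …, r^n_k)`. -/
def R (k : ℕ) : Matrix (Fin n) (Fin n) ℝ := Matrix.diagonal (r φ k)

/-- `A_k = Φ_k R_k⁻¹ Φ_kᵀ`. -/
def A (k : ℕ) : Matrix (Fin n × Fin m) (Fin n × Fin m) ℝ :=
  Phi φ k * (R φ k)⁻¹ * (Phi φ k)ᵀ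

/-- `X_k(Q) = diag(x^1_k(Q), …, x^n_k(Q))`. -/
def X (Q k : ℕ) : Matrix (Fin n) (Fin n) ℝ := Matrix.diagonal (x 𝒩 φ k Q)

/-- `G_k = A_k + ν (L ⊗ I_m) (X_k(Q) ⊗ I_m) (L ⊗ I_m)`. -/
def G (Q : ℕ) (ν : ℝ) (k : ℕ) : Matrix (Fin n × Fin m) (Fin n × Fin m) ℝ :=
  A φ k + ν • ((𝒩.laplacian ⊗ₖ (1 : Matrix (Fin m) (Fin m) ℝ))
    * (X 𝒩 φ Q k ⊗ₖ (1 : Matrix (Fin m) (Fin m) ℝ))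
    * (𝒩.laplacian ⊗ₖ (1 : Matrix (Fin m) (Fin m) ℝ)))

/-- `Ψ(k, 0)`, where `Ψ(k+1, 0) = (I - μ G_k) Ψ(k, 0)` and `Ψ(0, 0) = I`. -/
def Psi (Q : ℕ) (μ ν : ℝ) : ℕ → Matrix (Fin n × Fin m) (Fin n × Fin m) ℝ
  | 0 => 1
  | k + 1 => (1 - μ • G 𝒩 φ Q ν k) * Psi Q μ ν k

/-- `det (I - μ G_k) ≥ (det (I - A_k))^τ` at all times `k ≥ 1`. -/
def DetBound (Q : ℕ) (μ ν τ : ℝ) : Prop :=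
  ∀ k : ℕ, 1 ≤ k → (1 - A φ k).det ^ τ ≤ (1 - μ • G 𝒩 φ Q ν k).det

/-- The condition number of `R_k` is bounded in `k`. -/
def CondBounded : Prop :=
  ∃ γ : ℝ, 0 < γ ∧ ∀ k : ℕ, (⨆ i, r φ k i) / (⨅ i, r φ k i) ≤ γ

end Path

/-- The column vector stacked from `n` vectors of `ℝᵐ`, with its Euclidean norm. -/
def stack {n m : ℕ} (v : Fin n → EuclideanSpace ℝ (Fin m)) : EuclideanSpace ℝ (Fin n × Fin m) :=
  WithLp.toLp 2 fun p => v p.1 p.2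

section Noise

variable {Ω : Type*} {n m : ℕ}

/-- The σ-algebra `ℱ_k` generated by the regressors `φ^i_j`, `0 ≤ j ≤ k`, and the noises
`ε^i_j`, `1 ≤ j ≤ k`; here `Ξ j = (ε^1_j, …, ε^n_j)`. -/
@[reducible]
def history (φ : ℕ → Fin n → Ω → EuclideanSpace ℝ (Fin m)) (Ξ : ℕ → Ω → EuclideanSpace ℝ (Fin n))
    (k : ℕ) : MeasurableSpace Ω :=
  (⨆ j ∈ Finset.Icc 0 k, ⨆ i, MeasurableSpace.comap (φ j i) inferInstance) ⊔
    ⨆ j ∈ Finset.Icc 1 k, MeasurableSpace.comap (Ξ j) inferInstance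

/-- The noise is a martingale difference sequence with
`E(‖Ξ_{k+1}‖² | ℱ_k) ≤ c₀ ‖R_k‖^ε` almost surely, where `c₀ > 0` and `ε ∈ [0, 1)` may depend on
the sample point. The conditional expectation of `‖Ξ_{k+1}‖²` is taken in `[0, ∞]`, so that
`E ‖Ξ_{k+1}‖² < ∞` is not required. -/
structure NoiseCondition [MeasurableSpace Ω] (P : Measure Ω)
    (φ : ℕ → Fin n → Ω → EuclideanSpace ℝ (Fin m)) (Ξ : ℕ → Ω → EuclideanSpace ℝ (Fin n))
    (c₀ ε : Ω → ℝ) : Prop where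
  integrable : ∀ k, Integrable (Ξ (k + 1)) P
  condExp_zero : ∀ k, P[Ξ (k + 1) | history φ Ξ k] =ᵐ[P] 0
  constants : ∀ᵐ ω ∂P, 0 < c₀ ω ∧ ε ω ∈ Set.Ico (0 : ℝ) 1
  condVar_le : ∀ k, ∀ᵐ ω ∂P,
    condLExp (history φ Ξ k) P (fun ω' => ‖Ξ (k + 1) ω'‖ₑ ^ 2) ω
      ≤ ENNReal.ofReal (c₀ ω * ‖R (fun j i => φ j i ω) k‖ ^ ε ω)

end Noise

end DistSG

end

/-! Subtracting `θ` gives `e_{k+1} = (I - μ G_k) e_k + μ Φ_k R_k⁻¹ Ξ_{k+1}` (`error_succ`), so the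
rate must come from comparing the accumulated noise with the decay of `Ψ`.

Noise. Weighted by `r^(δ-1)`, the noise sums are martingale transforms. Their predictable variation
is finite because `∑ ‖φ_j‖² / r_j^(1+η)` converges and `δ < (1-ε)/2` leaves `η > 0`; hence they are
bounded almost surely (`ae_weighted_noise_bounded`). Abel summation then bounds the unweighted noise
between times `j` and `K` by a multiple of `‖R_j‖^(-δ)` (`norm_noiseSum_sub_le`).

Transition matrices. `det (I - A_k) = ∏ r_{k-1} / r_k` telescopes, so the determinant bound gives
`‖Ψ(j+1)⁻¹‖ ≲ (∏ r_j)^τ ≤ ‖R_j‖^(nτ)`. The transition `Ψ(K) Ψ(j+1)⁻¹` also has norm at most `1`, and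
interpolating the two bounds yields `‖Ψ(K)‖^s ‖R_j‖^(nτs)` up to a constant
(`norm_Psi_mul_Psi_inv_le`).

Combination. For fixed `K`, adding to `e_k` the noise still to come before `K` turns the forcing
term into `μ² G_k (U_K - U_k)` (`corrected_error_succ`), where `U` is the accumulated noise. Since
`‖G_k‖ ≲ ∑ ‖φ_k‖² / r_k`, variation of constants gives terms of size `‖Ψ(K)‖^s ∑ ‖φ_j‖² / r_j^(1+η)`
with `η = δ - nτs`. The choice `nτs = δ/(1+δ)` makes `η` positive, so the sum is bounded uniformly
in `K` (`exists_error_le`). -/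

namespace DistSG

/-! ### Spectral norm and determinant bounds from quadratic forms -/

section Spectral

variable {ι : Type*} [Fintype ι] [DecidableEq ι] {H : Matrix ι ι ℝ}

lemma eigenvalues_eq_dotProduct (hH : H.IsHermitian) (i : ι) :
    ∃ v : ι → ℝ, v ⬝ᵥ v = 1 ∧ v ⬝ᵥ H *ᵥ v = hH.eigenvalues i := by
  have h1 : (hH.eigenvectorBasis i).ofLp ⬝ᵥ (hH.eigenvectorBasis i).ofLp = 1 := by
    have h := hH.eigenvectorBasis.orthonormal.1 i
    have h2 := EuclideanSpace.real_norm_sq_eq (hH.eigenvectorBasis i)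
    rw [h] at h2
    simp only [dotProduct, ← sq]
    linarith
  refine ⟨(hH.eigenvectorBasis i).ofLp, h1, ?_⟩
  rw [hH.mulVec_eigenvectorBasis i, dotProduct_smul, h1]
  simp

lemma le_eigenvalues (hH : H.IsHermitian) {c : ℝ} (h : ∀ v, c * (v ⬝ᵥ v) ≤ v ⬝ᵥ H *ᵥ v) (i : ι) :
    c ≤ hH.eigenvalues i := by
  obtain ⟨v, h1, h2⟩ := eigenvalues_eq_dotProduct hH i
  simpa [h1, h2] using h v

lemma eigenvalues_le (hH : H.IsHermitian) {c : ℝ} (h : ∀ v, v ⬝ᵥ H *ᵥ v ≤ c * (v ⬝ᵥ v)) (i : ι) :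
    hH.eigenvalues i ≤ c := by
  obtain ⟨v, h1, h2⟩ := eigenvalues_eq_dotProduct hH i
  simpa [h1, h2] using h v

lemma eq_unitary_diagonal (hH : H.IsHermitian) :
    H = (hH.eigenvectorUnitary : Matrix ι ι ℝ) * Matrix.diagonal hH.eigenvalues *
      star (hH.eigenvectorUnitary : Matrix ι ι ℝ) := by
  have := hH.spectral_theorem
  rw [Unitary.conjStarAlgAut_apply] at this
  simpa [Function.comp_def] using this

lemma norm_unitary_diagonal (U : Matrix.unitaryGroup ι ℝ) (d : ι → ℝ) :
    ‖(U : Matrix ι ι ℝ) * Matrix.diagonal d * star (U : Matrix ι ι ℝ)‖ = ‖d‖ := by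
  rw [← Unitary.coe_star, CStarRing.norm_mul_coe_unitary, CStarRing.norm_coe_unitary_mul,
    Matrix.l2_opNorm_diagonal]

/-- A symmetric matrix with quadratic form in `[0, c]` has spectral norm at most `c`. -/
lemma norm_le_of_form (hH : H.IsHermitian) {c : ℝ} (hc : 0 ≤ c) (h0 : ∀ v, 0 ≤ v ⬝ᵥ H *ᵥ v)
    (h1 : ∀ v, v ⬝ᵥ H *ᵥ v ≤ c * (v ⬝ᵥ v)) : ‖H‖ ≤ c := by
  rw [eq_unitary_diagonal hH, norm_unitary_diagonal]
  refine (pi_norm_le_iff_of_nonneg hc).2 fun i => ?_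
  have := le_eigenvalues hH (c := 0) (by simpa using h0) i
  rw [Real.norm_of_nonneg this]
  exact eigenvalues_le hH h1 i

/-- If the quadratic form of `H` is at least `c` on unit vectors, then `det H ≥ c ^ N`. -/
lemma pow_le_det (hH : H.IsHermitian) {c : ℝ} (hc : 0 ≤ c)
    (h : ∀ v, c * (v ⬝ᵥ v) ≤ v ⬝ᵥ H *ᵥ v) : c ^ Fintype.card ι ≤ H.det := by
  rw [hH.det_eq_prod_eigenvalues, ← Finset.card_univ, ← Finset.prod_const]
  exact Finset.prod_le_prod (fun _ _ => hc) fun i _ => le_eigenvalues hH h i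

/-- For symmetric `0 ≤ H ≤ 1` with positive determinant, `‖H⁻¹‖ ≤ (det H)⁻¹`. -/
lemma norm_inv_le (hH : H.IsHermitian) (h0 : ∀ v, 0 ≤ v ⬝ᵥ H *ᵥ v)
    (h1 : ∀ v, v ⬝ᵥ H *ᵥ v ≤ v ⬝ᵥ v) (hd : 0 < H.det) : ‖H⁻¹‖ ≤ H.det⁻¹ := by
  have e0 : ∀ i, 0 ≤ hH.eigenvalues i := le_eigenvalues hH (by simpa using h0)
  have e1 : ∀ i, hH.eigenvalues i ≤ 1 := eigenvalues_le hH (by simpa using h1)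
  have hdet : H.det = ∏ i, hH.eigenvalues i := by simpa using hH.det_eq_prod_eigenvalues
  -- All eigenvalues lie in `[0, 1]`, so their product is below each of them.
  have hle : ∀ i, H.det ≤ hH.eigenvalues i := fun i => by
    rw [hdet, ← Finset.mul_prod_erase _ _ (Finset.mem_univ i)]
    exact mul_le_of_le_one_right (e0 i) (Finset.prod_le_one (fun j _ => e0 j) fun j _ => e1 j)
  have hpos : ∀ i, 0 < hH.eigenvalues i := fun i => hd.trans_le (hle i)
  have hinv : H⁻¹ = (hH.eigenvectorUnitary : Matrix ι ι ℝ) *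
      Matrix.diagonal (fun i => (hH.eigenvalues i)⁻¹) *
      star (hH.eigenvectorUnitary : Matrix ι ι ℝ) := by
    refine Matrix.inv_eq_right_inv ?_
    nth_rewrite 1 [eq_unitary_diagonal hH]
    have hU := Unitary.coe_star_mul_self hH.eigenvectorUnitary
    have hU' := Unitary.coe_mul_star_self hH.eigenvectorUnitary
    rw [Unitary.coe_star] at hU'
    have hD : Matrix.diagonal hH.eigenvalues * Matrix.diagonal (fun i => (hH.eigenvalues i)⁻¹)
        = 1 := by
      rw [Matrix.diagonal_mul_diagonal]
      simp [fun i => (hpos i).ne']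
    generalize (hH.eigenvectorUnitary : Matrix ι ι ℝ) = U at hU hU' ⊢
    calc _ = U * Matrix.diagonal hH.eigenvalues * (star U * U) *
          Matrix.diagonal (fun i => (hH.eigenvalues i)⁻¹) * star U := by noncomm_ring
      _ = 1 := by rw [hU, mul_one, mul_assoc U, hD, mul_one, hU']
  rw [hinv, norm_unitary_diagonal]
  refine (pi_norm_le_iff_of_nonneg (inv_nonneg.2 hd.le)).2 fun i => ?_
  rw [Real.norm_of_nonneg (inv_nonneg.2 (e0 i))]
  exact inv_anti₀ hd (hle i)

end Spectral

/-! ### Averaging and the graph Laplacian -/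

namespace Network

variable {n : ℕ} (𝒩 : Network n)

lemma weight_eq_zero {i j : Fin n} (h : j ∉ 𝒩.nbrs i) : 𝒩.weight i j = 0 := by
  classical
  have h' : ¬ (j = i ∨ i ≠ j ∧ 0 < 𝒩.weight i j) := fun hj =>
    h (Finset.mem_filter.2 ⟨Finset.mem_univ j, hj⟩)
  push Not at h'
  exact le_antisymm (h'.2 (Ne.symm h'.1)) (𝒩.nonneg i j)

lemma sum_nbrs {E : Type*} [AddCommGroup E] [Module ℝ E] (i : Fin n) (f : Fin n → E) :
    ∑ j ∈ 𝒩.nbrs i, 𝒩.weight i j • f j = ∑ j, 𝒩.weight i j • f j :=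
  Finset.sum_subset (Finset.subset_univ _) fun j _ h => by rw [𝒩.weight_eq_zero h, zero_smul]

lemma sum_weight_smul_sub {E : Type*} [AddCommGroup E] [Module ℝ E] (i : Fin n) (f : Fin n → E) :
    ∑ j ∈ 𝒩.nbrs i, 𝒩.weight i j • (f i - f j) = f i - ∑ j, 𝒩.weight i j • f j := by
  rw [𝒩.sum_nbrs i (fun j => f i - f j)]
  simp only [smul_sub, Finset.sum_sub_distrib, ← Finset.sum_smul, 𝒩.row_sum, one_smul]

lemma laplacian_isSymm : 𝒩.laplacian.IsSymm := Matrix.isSymm_one.sub 𝒩.symm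

lemma laplacian_mulVec (u : Fin n → ℝ) (i : Fin n) :
    (𝒩.laplacian *ᵥ u) i = u i - ∑ j, 𝒩.weight i j * u j := by
  rw [laplacian, Matrix.sub_mulVec, Matrix.one_mulVec]
  rfl

/-- Jensen in each row; by symmetry the column sums are also `1`. -/
lemma sum_sq_weight_le (u : Fin n → ℝ) :
    ∑ i, (∑ j, 𝒩.weight i j * u j) ^ 2 ≤ ∑ i, u i ^ 2 := by
  have h1 : ∀ i, (∑ j, 𝒩.weight i j * u j) ^ 2 ≤ ∑ j, 𝒩.weight i j * u j ^ 2 := fun i =>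
    Real.pow_arith_mean_le_arith_mean_pow_of_even _ _ u (fun j _ => 𝒩.nonneg i j) (𝒩.row_sum i)
      even_two
  calc _ ≤ ∑ i, ∑ j, 𝒩.weight i j * u j ^ 2 := Finset.sum_le_sum fun i _ => h1 i
    _ = ∑ j, (∑ i, 𝒩.weight j i) * u j ^ 2 := by
      rw [Finset.sum_comm]
      refine Finset.sum_congr rfl fun j _ => ?_
      rw [Finset.sum_mul]
      exact Finset.sum_congr rfl fun i _ => by rw [𝒩.symm.apply]
    _ = _ := by simp [𝒩.row_sum]

/-- The factor `4`, from `(a - b)² ≤ 2a² + 2b²`, is the source of `1 + 4ν`. -/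
lemma sum_sq_laplacian_le (u : Fin n → ℝ) :
    ∑ i, (𝒩.laplacian *ᵥ u) i ^ 2 ≤ 4 * ∑ i, u i ^ 2 := by
  have h : ∀ i, (𝒩.laplacian *ᵥ u) i ^ 2 ≤ 2 * u i ^ 2 + 2 * (∑ j, 𝒩.weight i j * u j) ^ 2 :=
    fun i => by
      rw [laplacian_mulVec]
      nlinarith [sq_nonneg (u i + ∑ j, 𝒩.weight i j * u j)]
  have := Finset.sum_le_sum fun i (_ : i ∈ Finset.univ) => h i
  rw [Finset.sum_add_distrib, ← Finset.mul_sum, ← Finset.mul_sum] at this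
  linarith [𝒩.sum_sq_weight_le u]

end Network

/-! ### One realization: bounds on `G_k`, `det (I - A_k)` and `Ψ` -/

section Path

variable {n m : ℕ} (𝒩 : Network n) (φ : ℕ → Fin n → EuclideanSpace ℝ (Fin m))

lemma one_le_r (k : ℕ) (i : Fin n) : 1 ≤ r φ k i :=
  le_add_of_nonneg_right (Finset.sum_nonneg fun _ _ => by positivity)

lemma r_pos (k : ℕ) (i : Fin n) : 0 < r φ k i := one_pos.trans_le (one_le_r φ k i)

lemma r_zero (i : Fin n) : r φ 0 i = 1 := by simp [r]

lemma r_succ (k : ℕ) (i : Fin n) : r φ (k + 1) i = r φ k i + ‖φ (k + 1) i‖ ^ 2 := by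
  rw [r, r, Finset.sum_Icc_succ_top (by omega)]
  ring

lemma r_mono (i : Fin n) : Monotone fun k => r φ k i :=
  monotone_nat_of_le_succ fun k => by
    simp only [r_succ]
    exact le_add_of_nonneg_right (by positivity)

lemma x_zero_nonneg (k : ℕ) (i : Fin n) : 0 ≤ x 𝒩 φ k 0 i :=
  div_nonneg (by positivity) (r_pos φ k i).le

/-- The time index is shifted because `r_0 = 1` does not contain `φ_0`; time `0` is therefore
exceptional throughout. -/
lemma one_sub_x_zero (k : ℕ) (i : Fin n) :
    1 - x 𝒩 φ (k + 1) 0 i = r φ k i / r φ (k + 1) i := by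
  have := r_pos φ (k + 1) i
  rw [x, eq_div_iff this.ne', sub_mul, div_mul_cancel₀ _ this.ne', r_succ]
  ring

lemma x_succ (k q : ℕ) (i : Fin n) : x 𝒩 φ k (q + 1) i = ∑ j, 𝒩.weight i j * x 𝒩 φ k q j := by
  simpa [x] using 𝒩.sum_nbrs i (x 𝒩 φ k q)

lemma x_nonneg (k q : ℕ) (i : Fin n) : 0 ≤ x 𝒩 φ k q i := by
  induction q generalizing i with
  | zero => exact x_zero_nonneg 𝒩 φ k i
  | succ q ih =>
    rw [x_succ]
    exact Finset.sum_nonneg fun j _ => mul_nonneg (𝒩.nonneg i j) (ih j)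

/-- Diffusion is averaging, so it cannot raise the maximum. -/
lemma x_le {k : ℕ} {c : ℝ} (hc : ∀ i, x 𝒩 φ k 0 i ≤ c) (q : ℕ) (i : Fin n) :
    x 𝒩 φ k q i ≤ c := by
  induction q generalizing i with
  | zero => exact hc i
  | succ q ih =>
    rw [x_succ]
    calc _ ≤ ∑ j, 𝒩.weight i j * c :=
          Finset.sum_le_sum fun j _ => mul_le_mul_of_nonneg_left (ih j) (𝒩.nonneg i j)
      _ = c := by rw [← Finset.sum_mul, 𝒩.row_sum, one_mul]

lemma R_inv (k : ℕ) : (R φ k)⁻¹ = Matrix.diagonal fun i => (r φ k i)⁻¹ := by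
  refine Matrix.inv_eq_right_inv ?_
  rw [R, Matrix.diagonal_mul_diagonal]
  simp [fun i => (r_pos φ k i).ne']

lemma Phi_transpose_mulVec (k : ℕ) (v : Fin n × Fin m → ℝ) (i : Fin n) :
    ((Phi φ k)ᵀ *ᵥ v) i = ∑ a, φ k i a * v (i, a) := by
  simp only [Matrix.mulVec, dotProduct, Matrix.transpose_apply, Phi, Matrix.of_apply,
    Fintype.sum_prod_type]
  rw [Finset.sum_eq_single i]
  · simp
  · intro j _ hj
    simp [hj]
  · simp

lemma Phi_mulVec (k : ℕ) (u : Fin n → ℝ) (p : Fin n × Fin m) :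
    (Phi φ k *ᵥ u) p = φ k p.1 p.2 * u p.1 := by
  simp [Matrix.mulVec, dotProduct, Phi]

lemma A_mulVec (k : ℕ) (v : Fin n × Fin m → ℝ) (p : Fin n × Fin m) :
    (A φ k *ᵥ v) p = φ k p.1 p.2 * ((r φ k p.1)⁻¹ * ∑ a, φ k p.1 a * v (p.1, a)) := by
  rw [A, ← Matrix.mulVec_mulVec, ← Matrix.mulVec_mulVec, Phi_mulVec, R_inv, Matrix.mulVec_diagonal,
    Phi_transpose_mulVec]

lemma laplacian_kronecker_mulVec (v : Fin n × Fin m → ℝ) (p : Fin n × Fin m) :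
    ((𝒩.laplacian ⊗ₖ (1 : Matrix (Fin m) (Fin m) ℝ)) *ᵥ v) p
      = (𝒩.laplacian *ᵥ fun j => v (j, p.2)) p.1 := by
  simp [Matrix.mulVec, dotProduct, Fintype.sum_prod_type, Matrix.kroneckerMap_apply,
    Matrix.one_apply]

lemma X_kronecker_mulVec (Q k : ℕ) (v : Fin n × Fin m → ℝ) (p : Fin n × Fin m) :
    ((X 𝒩 φ Q k ⊗ₖ (1 : Matrix (Fin m) (Fin m) ℝ)) *ᵥ v) p = x 𝒩 φ k Q p.1 * v p := by
  simp [X, Matrix.mulVec, dotProduct, Fintype.sum_prod_type, Matrix.kroneckerMap_apply,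
    Matrix.one_apply, Matrix.diagonal_apply]

lemma G_mulVec (Q k : ℕ) (ν : ℝ) (v : Fin n × Fin m → ℝ) (p : Fin n × Fin m) :
    (G 𝒩 φ Q ν k *ᵥ v) p = (A φ k *ᵥ v) p + ν * (𝒩.laplacian *ᵥ fun j =>
      x 𝒩 φ k Q j * (𝒩.laplacian *ᵥ fun l => v (l, p.2)) j) p.1 := by
  rw [G, Matrix.add_mulVec, Matrix.smul_mulVec, Pi.add_apply, Pi.smul_apply, smul_eq_mul,
    ← Matrix.mulVec_mulVec, ← Matrix.mulVec_mulVec, laplacian_kronecker_mulVec]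
  simp only [X_kronecker_mulVec, laplacian_kronecker_mulVec]

/-- Symmetry of the Laplacian moves one factor across, exhibiting the form as a weighted sum of
squares. -/
lemma dotProduct_G (Q k : ℕ) (ν : ℝ) (v : Fin n × Fin m → ℝ) :
    v ⬝ᵥ G 𝒩 φ Q ν k *ᵥ v = ∑ i, (∑ a, φ k i a * v (i, a)) ^ 2 / r φ k i +
      ν * ∑ a, ∑ i, x 𝒩 φ k Q i * (𝒩.laplacian *ᵥ fun j => v (j, a)) i ^ 2 := by
  have h1 : v ⬝ᵥ A φ k *ᵥ v = ∑ i, (∑ a, φ k i a * v (i, a)) ^ 2 / r φ k i := by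
    simp only [dotProduct, A_mulVec, Fintype.sum_prod_type]
    refine Finset.sum_congr rfl fun i _ => ?_
    rw [sq, mul_div_assoc, Finset.sum_mul]
    refine Finset.sum_congr rfl fun a _ => ?_
    ring
  have h2 : v ⬝ᵥ G 𝒩 φ Q ν k *ᵥ v = v ⬝ᵥ A φ k *ᵥ v + ν * ∑ a, (fun i => v (i, a)) ⬝ᵥ
      𝒩.laplacian *ᵥ fun j => x 𝒩 φ k Q j * (𝒩.laplacian *ᵥ fun l => v (l, a)) j := by
    simp only [dotProduct, G_mulVec, mul_add, Finset.sum_add_distrib, Finset.mul_sum,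
      Fintype.sum_prod_type]
    congr 1
    rw [Finset.sum_comm]
    exact Finset.sum_congr rfl fun i _ => Finset.sum_congr rfl fun a _ => by ring
  rw [h2, h1]
  congr 2
  refine Finset.sum_congr rfl fun a _ => ?_
  rw [Matrix.dotProduct_mulVec, ← Matrix.mulVec_transpose, 𝒩.laplacian_isSymm.eq]
  exact Finset.sum_congr rfl fun i _ => by ring

lemma G_isHermitian (Q k : ℕ) (ν : ℝ) : (G 𝒩 φ Q ν k).IsHermitian := by
  have hs : (G 𝒩 φ Q ν k)ᵀ = G 𝒩 φ Q ν k := by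
    have hA : (A φ k)ᵀ = A φ k := by
      simp [A, R_inv, Matrix.transpose_mul, Matrix.mul_assoc]
    simp only [G, Matrix.transpose_add, Matrix.transpose_smul, Matrix.transpose_mul, hA,
      ← Matrix.kroneckerMap_transpose, 𝒩.laplacian_isSymm.eq, Matrix.transpose_one, X,
      Matrix.diagonal_transpose, Matrix.mul_assoc]
  simpa [Matrix.IsHermitian, Matrix.conjTranspose_eq_transpose_of_trivial] using hs

lemma dotProduct_G_nonneg (Q k : ℕ) {ν : ℝ} (hν : 0 ≤ ν) (v : Fin n × Fin m → ℝ) :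
    0 ≤ v ⬝ᵥ G 𝒩 φ Q ν k *ᵥ v := by
  rw [dotProduct_G]
  refine add_nonneg (Finset.sum_nonneg fun i _ => div_nonneg (sq_nonneg _) (r_pos φ k i).le)
    (mul_nonneg hν (Finset.sum_nonneg fun a _ => Finset.sum_nonneg fun i _ => ?_))
  exact mul_nonneg (x_nonneg 𝒩 φ k Q i) (sq_nonneg _)

lemma dotProduct_G_le {Q k : ℕ} {ν c : ℝ} (hν : 0 ≤ ν) (hc0 : 0 ≤ c)
    (hc : ∀ i, x 𝒩 φ k 0 i ≤ c) (v : Fin n × Fin m → ℝ) :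
    v ⬝ᵥ G 𝒩 φ Q ν k *ᵥ v ≤ (1 + 4 * ν) * c * (v ⬝ᵥ v) := by
  have hv : v ⬝ᵥ v = ∑ i, ∑ a, v (i, a) ^ 2 := by
    simp [dotProduct, Fintype.sum_prod_type, sq]
  have h1 : ∑ i, (∑ a, φ k i a * v (i, a)) ^ 2 / r φ k i ≤ c * (v ⬝ᵥ v) := by
    rw [hv, Finset.mul_sum]
    refine Finset.sum_le_sum fun i _ => ?_
    have h := Finset.sum_mul_sq_le_sq_mul_sq Finset.univ (fun a => φ k i a) fun a => v (i, a)
    rw [← EuclideanSpace.real_norm_sq_eq] at h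
    calc _ ≤ ‖φ k i‖ ^ 2 * (∑ a, v (i, a) ^ 2) / r φ k i :=
          div_le_div_of_nonneg_right h (r_pos φ k i).le
      _ = x 𝒩 φ k 0 i * ∑ a, v (i, a) ^ 2 := by rw [x]; ring
      _ ≤ _ := mul_le_mul_of_nonneg_right (hc i) (Finset.sum_nonneg fun _ _ => sq_nonneg _)
  have h2 : ∑ a, ∑ i, x 𝒩 φ k Q i * (𝒩.laplacian *ᵥ fun j => v (j, a)) i ^ 2
      ≤ 4 * c * (v ⬝ᵥ v) := by
    rw [hv, Finset.sum_comm (s := Finset.univ (α := Fin n)), Finset.mul_sum]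
    refine Finset.sum_le_sum fun a _ => ?_
    calc _ ≤ ∑ i, c * (𝒩.laplacian *ᵥ fun j => v (j, a)) i ^ 2 := Finset.sum_le_sum fun i _ =>
          mul_le_mul_of_nonneg_right (x_le 𝒩 φ hc Q i) (sq_nonneg _)
      _ ≤ c * (4 * ∑ i, v (i, a) ^ 2) := by
        rw [← Finset.mul_sum]
        exact mul_le_mul_of_nonneg_left (𝒩.sum_sq_laplacian_le _) hc0
      _ = _ := by ring
  rw [dotProduct_G]
  nlinarith [mul_le_mul_of_nonneg_left h2 hν]

lemma norm_G_le {Q k : ℕ} {ν c : ℝ} (hν : 0 ≤ ν) (hc0 : 0 ≤ c)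
    (hc : ∀ i, x 𝒩 φ k 0 i ≤ c) : ‖G 𝒩 φ Q ν k‖ ≤ (1 + 4 * ν) * c :=
  norm_le_of_form (G_isHermitian 𝒩 φ Q k ν) (by positivity) (dotProduct_G_nonneg 𝒩 φ Q k hν)
    (dotProduct_G_le 𝒩 φ hν hc0 hc)

/-- Sylvester's identity `det (1 - BC) = det (1 - CB)` reduces to an `n × n` diagonal matrix. -/
lemma det_one_sub_A (k : ℕ) : (1 - A φ k).det = ∏ i, (1 - x 𝒩 φ k 0 i) := by
  have h : (R φ k)⁻¹ * (Phi φ k)ᵀ * Phi φ k = Matrix.diagonal (x 𝒩 φ k 0) := by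
    rw [R_inv, Matrix.mul_assoc]
    ext i j
    rw [Matrix.diagonal_mul]
    simp only [Matrix.mul_apply, Matrix.transpose_apply, Phi, Matrix.of_apply,
      Fintype.sum_prod_type, Matrix.diagonal_apply, x, EuclideanSpace.real_norm_sq_eq]
    rw [Finset.sum_eq_single i (by intro l _ hl; simp [hl]) (by simp)]
    by_cases hij : i = j
    · subst hij
      simp [div_eq_inv_mul, sq]
    · simp [hij]
  rw [A, Matrix.mul_assoc, Matrix.det_one_sub_mul_comm, h, ← Matrix.diagonal_one,
    Matrix.diagonal_sub, Matrix.det_diagonal]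

lemma det_one_sub_A_succ (k : ℕ) : (1 - A φ (k + 1)).det = ∏ i, r φ k i / r φ (k + 1) i := by
  -- the trivial network only serves to name the ratios `‖φ‖² / r`
  let 𝒩₁ : Network n := ⟨1, fun i j => by by_cases h : i = j <;> simp [h, Matrix.one_apply],
    Matrix.isSymm_one, fun i => by simp [Matrix.one_apply]⟩
  rw [det_one_sub_A 𝒩₁]
  exact Finset.prod_congr rfl fun i _ => one_sub_x_zero 𝒩₁ φ k i

lemma det_one_sub_A_succ_pos (k : ℕ) : 0 < (1 - A φ (k + 1)).det := by
  rw [det_one_sub_A_succ]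
  exact Finset.prod_pos fun i _ => div_pos (r_pos φ _ i) (r_pos φ _ i)

lemma x_zero_le_one_sub_det (k : ℕ) (i : Fin n) :
    x 𝒩 φ (k + 1) 0 i ≤ 1 - (1 - A φ (k + 1)).det := by
  have h0 : ∀ j, 0 ≤ 1 - x 𝒩 φ (k + 1) 0 j := fun j => by
    rw [one_sub_x_zero]
    exact (div_pos (r_pos φ _ j) (r_pos φ _ j)).le
  rw [det_one_sub_A 𝒩, ← Finset.mul_prod_erase _ _ (Finset.mem_univ i)]
  have : ∏ j ∈ Finset.univ.erase i, (1 - x 𝒩 φ (k + 1) 0 j) ≤ 1 :=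
    Finset.prod_le_one (fun j _ => h0 j) fun j _ => by linarith [x_zero_nonneg 𝒩 φ (k + 1) j]
  nlinarith [h0 i, mul_le_of_le_one_right (h0 i) this]

lemma det_one_sub_A_succ_le_one (k : ℕ) : (1 - A φ (k + 1)).det ≤ 1 := by
  rw [det_one_sub_A_succ]
  exact Finset.prod_le_one (fun i _ => (div_pos (r_pos φ _ i) (r_pos φ _ i)).le) fun i _ =>
    div_le_one_of_le₀ (r_mono φ i k.le_succ) (r_pos φ _ i).le

variable {Q : ℕ} {μ ν τ : ℝ}

lemma dotProduct_one_sub_G (k : ℕ) (v : Fin n × Fin m → ℝ) :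
    v ⬝ᵥ (1 - μ • G 𝒩 φ Q ν k) *ᵥ v = v ⬝ᵥ v - μ * (v ⬝ᵥ G 𝒩 φ Q ν k *ᵥ v) := by
  rw [Matrix.sub_mulVec, Matrix.one_mulVec, dotProduct_sub, Matrix.smul_mulVec, dotProduct_smul,
    smul_eq_mul]

lemma one_sub_G_isHermitian (k : ℕ) : (1 - μ • G 𝒩 φ Q ν k).IsHermitian := by
  refine Matrix.isHermitian_one.sub ?_
  have := (G_isHermitian 𝒩 φ Q k ν).eq
  rw [Matrix.IsHermitian, Matrix.conjTranspose_smul, this]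
  simp

/-- With `c = 1 - det (I - A)`, every `x` is at most `c`, so the form of `μ G` is at most `μ (1 +
4ν) c ≤ c` on unit vectors, leaving `1 - c = det (I - A)`. -/
lemma det_mul_le_dotProduct (hμ : 0 ≤ μ) (hν : 0 ≤ ν) (hμν : μ * (1 + 4 * ν) ≤ 1) (k : ℕ)
    (v : Fin n × Fin m → ℝ) :
    (1 - A φ (k + 1)).det * (v ⬝ᵥ v) ≤ v ⬝ᵥ (1 - μ • G 𝒩 φ Q ν (k + 1)) *ᵥ v := by
  have hc : 0 ≤ 1 - (1 - A φ (k + 1)).det := by linarith [det_one_sub_A_succ_le_one φ k]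
  have h := dotProduct_G_le 𝒩 φ (Q := Q) hν hc (x_zero_le_one_sub_det 𝒩 φ k) v
  have hv : 0 ≤ v ⬝ᵥ v := Finset.sum_nonneg fun i _ => mul_self_nonneg _
  rw [dotProduct_one_sub_G]
  have h1 := mul_le_mul_of_nonneg_left h hμ
  have h2 := mul_le_mul_of_nonneg_right hμν (mul_nonneg hc hv)
  nlinarith

lemma dotProduct_one_sub_G_nonneg (hμ : 0 ≤ μ) (hν : 0 ≤ ν) (hμν : μ * (1 + 4 * ν) ≤ 1) (k : ℕ)
    (v : Fin n × Fin m → ℝ) : 0 ≤ v ⬝ᵥ (1 - μ • G 𝒩 φ Q ν (k + 1)) *ᵥ v :=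
  (mul_nonneg (det_one_sub_A_succ_pos φ k).le
    (Finset.sum_nonneg fun _ _ => mul_self_nonneg _)).trans
    (det_mul_le_dotProduct 𝒩 φ hμ hν hμν k v)

lemma dotProduct_one_sub_G_le (hμ : 0 ≤ μ) (hν : 0 ≤ ν) (k : ℕ)
    (v : Fin n × Fin m → ℝ) : v ⬝ᵥ (1 - μ • G 𝒩 φ Q ν k) *ᵥ v ≤ v ⬝ᵥ v := by
  rw [dotProduct_one_sub_G]
  linarith [mul_nonneg hμ (dotProduct_G_nonneg 𝒩 φ Q k hν v)]

lemma detBound_mul (hμ : 0 ≤ μ) (hν : 0 ≤ ν) (hμν : μ * (1 + 4 * ν) ≤ 1) :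
    DetBound 𝒩 φ Q μ ν ((m : ℝ) * n) := by
  intro k hk
  obtain ⟨k, rfl⟩ := Nat.exists_eq_add_of_le' hk
  have h := pow_le_det (one_sub_G_isHermitian 𝒩 φ (Q := Q) (μ := μ) (ν := ν) (k + 1))
    (det_one_sub_A_succ_pos φ k).le (det_mul_le_dotProduct 𝒩 φ hμ hν hμν k)
  have hcard : (m : ℝ) * n = ((Fintype.card (Fin n × Fin m) : ℕ) : ℝ) := by
    simp [mul_comm]
  rwa [hcard, Real.rpow_natCast]

lemma norm_one_sub_G_le (hμ : 0 ≤ μ) (hν : 0 ≤ ν) (hμν : μ * (1 + 4 * ν) ≤ 1) (k : ℕ) :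
    ‖1 - μ • G 𝒩 φ Q ν (k + 1)‖ ≤ 1 :=
  norm_le_of_form (one_sub_G_isHermitian 𝒩 φ _) zero_le_one
    (dotProduct_one_sub_G_nonneg 𝒩 φ hμ hν hμν k)
    (by simpa using dotProduct_one_sub_G_le 𝒩 φ hμ hν (k + 1))

lemma det_one_sub_G_pos (hdet : DetBound 𝒩 φ Q μ ν τ) (k : ℕ) :
    0 < (1 - μ • G 𝒩 φ Q ν (k + 1)).det :=
  (Real.rpow_pos_of_pos (det_one_sub_A_succ_pos φ k) τ).trans_le (hdet (k + 1) (by omega))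

lemma det_Psi_ne_zero (h0 : (1 - μ • G 𝒩 φ Q ν 0).det ≠ 0) (hdet : DetBound 𝒩 φ Q μ ν τ)
    (k : ℕ) : (Psi 𝒩 φ Q μ ν k).det ≠ 0 := by
  induction k with
  | zero => simp [Psi]
  | succ k ih =>
    rw [Psi, Matrix.det_mul]
    refine mul_ne_zero ?_ ih
    cases k with
    | zero => exact h0
    | succ k => exact (det_one_sub_G_pos 𝒩 φ hdet k).ne'

/-- Each inverse factor costs at most `det (I - A)^(-τ)`, and these powers telescope to one of `∏
r`. The factor at time `0`, outside the determinant bound, stays in `Ψ(1)⁻¹`. -/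
lemma norm_Psi_inv_le (hμ : 0 ≤ μ) (hν : 0 ≤ ν) (hμν : μ * (1 + 4 * ν) ≤ 1)
    (hdet : DetBound 𝒩 φ Q μ ν τ) (k : ℕ) :
    ‖(Psi 𝒩 φ Q μ ν (k + 1))⁻¹‖ ≤ ‖(Psi 𝒩 φ Q μ ν 1)⁻¹‖ * (∏ i, r φ k i) ^ τ := by
  induction k with
  | zero => simp [r_zero]
  | succ k ih =>
    have hA := det_one_sub_A_succ_pos φ k
    have hprod : ∀ k, 0 < ∏ i, r φ k i := fun k => Finset.prod_pos fun i _ => r_pos φ k i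
    rw [Psi, Matrix.mul_inv_rev]
    refine (norm_mul_le _ _).trans ?_
    have h1 : ‖(1 - μ • G 𝒩 φ Q ν (k + 1))⁻¹‖ ≤ ((1 - A φ (k + 1)).det⁻¹) ^ τ := by
      refine (norm_inv_le (one_sub_G_isHermitian 𝒩 φ _)
        (dotProduct_one_sub_G_nonneg 𝒩 φ hμ hν hμν k)
        (dotProduct_one_sub_G_le 𝒩 φ hμ hν (k + 1)) (det_one_sub_G_pos 𝒩 φ hdet k)).trans ?_
      rw [Real.inv_rpow hA.le]
      exact inv_anti₀ (Real.rpow_pos_of_pos hA τ) (hdet (k + 1) (by omega))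
    have h2 : ∏ i, r φ (k + 1) i = (∏ i, r φ k i) * (1 - A φ (k + 1)).det⁻¹ := by
      rw [det_one_sub_A_succ, Finset.prod_div_distrib, inv_div]
      field_simp [(hprod k).ne']
    rw [h2, Real.mul_rpow (hprod k).le (inv_pos.2 hA).le, ← mul_assoc]
    exact mul_le_mul ih h1 (norm_nonneg _)
      (mul_nonneg (norm_nonneg _) (Real.rpow_nonneg (hprod k).le τ))

lemma norm_Psi_mul_Psi_inv_le_one (hμ : 0 ≤ μ) (hν : 0 ≤ ν) (hμν : μ * (1 + 4 * ν) ≤ 1)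
    (h0 : (1 - μ • G 𝒩 φ Q ν 0).det ≠ 0) (hdet : DetBound 𝒩 φ Q μ ν τ) {j k : ℕ} (hjk : j < k) :
    ‖Psi 𝒩 φ Q μ ν k * (Psi 𝒩 φ Q μ ν (j + 1))⁻¹‖ ≤ 1 := by
  induction k, Nat.succ_le_of_lt hjk using Nat.le_induction with
  | base =>
    rw [Nat.succ_eq_add_one,
      Matrix.mul_nonsing_inv _ (det_Psi_ne_zero 𝒩 φ h0 hdet (j + 1)).isUnit]
    exact norm_le_of_form Matrix.isHermitian_one zero_le_one
      (fun v => by rw [Matrix.one_mulVec]; exact Finset.sum_nonneg fun i _ => mul_self_nonneg _)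
      (fun v => by simp)
  | succ k hk ih =>
    obtain ⟨l, rfl⟩ := Nat.exists_eq_add_of_le' (Nat.one_le_of_lt hk)
    rw [Psi, Matrix.mul_assoc]
    exact (norm_mul_le _ _).trans
      (mul_le_one₀ (norm_one_sub_G_le 𝒩 φ hμ hν hμν l) (norm_nonneg _) (ih (by omega)))

end Path

/-! ### Elementary inequalities and variation of constants -/

section Elementary

/-- Comparison with `∫ t^(-1-η) dt` over `[a, b]`: the right side telescopes along a monotone
sequence. -/
lemma sub_div_rpow_le {a b η : ℝ} (ha : 0 < a) (hab : a ≤ b) (hη : 0 < η) :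
    (b - a) / b ^ (1 + η) ≤ (a ^ (-η) - b ^ (-η)) / η := by
  have hb : 0 < b := ha.trans_le hab
  have ht : 0 < a / b := div_pos ha hb
  have h1 : 1 + η * (1 - a / b) ≤ (a / b) ^ (-η) := by
    rw [Real.rpow_def_of_pos ht]
    have := Real.log_le_sub_one_of_pos ht
    nlinarith [Real.add_one_le_exp (Real.log (a / b) * -η)]
  have h2 : (a / b) ^ (-η) * b ^ (-η) = a ^ (-η) := by
    rw [← Real.mul_rpow ht.le hb.le, div_mul_cancel₀ _ hb.ne']
  have h3 : (b - a) / b ^ (1 + η) = (1 - a / b) * b ^ (-η) := by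
    rw [Real.rpow_add hb, Real.rpow_one, Real.rpow_neg hb.le]
    field_simp
  rw [h3, le_div_iff₀ hη, ← h2]
  nlinarith [mul_le_mul_of_nonneg_right h1 (Real.rpow_pos_of_pos hb (-η)).le]

lemma le_rpow_of_le_one_of_le {x y s : ℝ} (hy : 0 ≤ y) (hy1 : y ≤ 1) (hyx : y ≤ x) (hs0 : 0 ≤ s)
    (hs1 : s ≤ 1) : y ≤ x ^ s :=
  calc y = y ^ (1 : ℝ) := (Real.rpow_one y).symm
    _ ≤ y ^ s := Real.rpow_le_rpow_of_exponent_ge' hy hy1 hs0 hs1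
    _ ≤ x ^ s := Real.rpow_le_rpow hy hyx hs0

/-- Abel's inequality for a bounded sequence of partial sums and antitone weights. -/
lemma abs_sum_Ico_mul_sub_le {S b : ℕ → ℝ} {B : ℝ} (hS : ∀ k, |S k| ≤ B) (hb : Antitone b)
    (hb0 : ∀ k, 0 ≤ b k) {j K : ℕ} (hjK : j ≤ K) :
    |∑ l ∈ Finset.Ico j K, b l * (S (l + 1) - S l)| ≤ 2 * B * b j := by
  -- With the boundary term removed, each step adds only `(b K - b (K + 1)) * S (K + 1)`, whose
  -- bounds telescope.
  have key : |∑ l ∈ Finset.Ico j K, b l * (S (l + 1) - S l) - b K * S K|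
      ≤ B * b j + B * (b j - b K) := by
    induction K, hjK using Nat.le_induction with
    | base =>
      simp only [Finset.Ico_self, Finset.sum_empty, zero_sub, abs_neg, abs_mul, sub_self, mul_zero,
        add_zero, abs_of_nonneg (hb0 j)]
      nlinarith [hS j, hb0 j]
    | succ K hK ih =>
      rw [Finset.sum_Ico_succ_top hK]
      have h1 : |(b K - b (K + 1)) * S (K + 1)| ≤ B * (b K - b (K + 1)) := by
        rw [abs_mul, abs_of_nonneg (sub_nonneg.2 (hb K.le_succ)), mul_comm]
        exact mul_le_mul_of_nonneg_right (hS _) (sub_nonneg.2 (hb K.le_succ))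
      have h2 := abs_add_le (∑ l ∈ Finset.Ico j K, b l * (S (l + 1) - S l) - b K * S K)
        ((b K - b (K + 1)) * S (K + 1))
      calc _ = |∑ l ∈ Finset.Ico j K, b l * (S (l + 1) - S l) - b K * S K +
            (b K - b (K + 1)) * S (K + 1)| := by ring_nf
        _ ≤ _ := by linarith
  have h1 : |b K * S K| ≤ B * b K := by
    rw [abs_mul, abs_of_nonneg (hb0 K), mul_comm]
    exact mul_le_mul_of_nonneg_right (hS K) (hb0 K)
  have h2 := abs_add_le (∑ l ∈ Finset.Ico j K, b l * (S (l + 1) - S l) - b K * S K) (b K * S K)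
  rw [sub_add_cancel] at h2
  linarith

lemma norm_toLp_le {ι : Type*} [Fintype ι] {v : ι → ℝ} {c : ℝ} (hc : 0 ≤ c)
    (hv : ∀ p, |v p| ≤ c) : ‖WithLp.toLp 2 v‖ ≤ √(Fintype.card ι) * c := by
  refine abs_le_of_sq_le_sq' ?_ (by positivity) |>.2
  rw [EuclideanSpace.real_norm_sq_eq, mul_pow, Real.sq_sqrt (by positivity), ← Finset.card_univ,
    ← nsmul_eq_mul]
  exact Finset.sum_le_card_nsmul _ _ _ fun p _ => sq_le_sq' (abs_le.1 (hv p)).1 (abs_le.1 (hv p)).2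

/-- Variation of constants for a linear recursion with invertible transition matrices. -/
lemma eq_transition_add_sum {ι : Type*} [Fintype ι] [DecidableEq ι] {H Ψ : ℕ → Matrix ι ι ℝ}
    {f g : ℕ → ι → ℝ} (h0 : Ψ 0 = 1) (hΨ : ∀ k, Ψ (k + 1) = H k * Ψ k)
    (hdet : ∀ k, (Ψ k).det ≠ 0) (hf : ∀ k, f (k + 1) = H k *ᵥ f k + g k) (K : ℕ) :
    f K = Ψ K *ᵥ f 0 + ∑ j ∈ Finset.range K, (Ψ K * (Ψ (j + 1))⁻¹) *ᵥ g j := by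
  induction K with
  | zero => simp [h0]
  | succ K ih =>
    rw [Finset.sum_range_succ, Matrix.mul_nonsing_inv _ (hdet _).isUnit, Matrix.one_mulVec, hf K,
      ih, Matrix.mulVec_add, hΨ K, Matrix.mulVec_mulVec, ← add_assoc, Matrix.mulVec_sum]
    simp only [Matrix.mulVec_mulVec, Matrix.mul_assoc]

end Elementary

/-! ### Convergence rate on a fixed path -/

section Path

variable {n m : ℕ} (𝒩 : Network n) (φ : ℕ → Fin n → EuclideanSpace ℝ (Fin m))

lemma sum_sq_div_r_rpow_le {η : ℝ} (hη : 0 < η) (i : Fin n) (K : ℕ) :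
    ∑ j ∈ Finset.range K, ‖φ j i‖ ^ 2 / r φ j i ^ (1 + η) ≤ ‖φ 0 i‖ ^ 2 + 1 / η := by
  have h : ∀ K, ∑ j ∈ Finset.range (K + 1), ‖φ j i‖ ^ 2 / r φ j i ^ (1 + η)
      ≤ ‖φ 0 i‖ ^ 2 + (1 - r φ K i ^ (-η)) / η := by
    intro K
    induction K with
    | zero => simp [r_zero]
    | succ K ih =>
      rw [Finset.sum_range_succ]
      have h := sub_div_rpow_le (r_pos φ K i) (r_mono φ i K.le_succ) hη
      have h2 : r φ (K + 1) i - r φ K i = ‖φ (K + 1) i‖ ^ 2 := by rw [r_succ]; ring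
      simp only [Nat.succ_eq_add_one, h2] at h
      calc _ ≤ _ := add_le_add ih h
        _ = _ := by ring
  cases K with
  | zero => simp; positivity
  | succ K =>
    refine (h K).trans (add_le_add_right ?_ _)
    gcongr
    linarith [Real.rpow_pos_of_pos (r_pos φ K i) (-η)]

/-- The estimation error obeys `e_{k+1} = (I - μ G_k) e_k + μ Φ_k R_k⁻¹ Ξ_{k+1}`. -/
lemma error_succ (Q : ℕ) (μ ν : ℝ) (θ : EuclideanSpace ℝ (Fin m)) (y ξ : ℕ → Fin n → ℝ)
    (hy : ∀ k i, y (k + 1) i = inner ℝ θ (φ k i) + ξ (k + 1) i)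
    (θ₀ : Fin n → EuclideanSpace ℝ (Fin m)) (k : ℕ) :
    (fun p : Fin n × Fin m => estimate 𝒩 φ Q μ ν y θ₀ (k + 1) p.1 p.2 - θ p.2) =
      (1 - μ • G 𝒩 φ Q ν k) *ᵥ (fun p => estimate 𝒩 φ Q μ ν y θ₀ k p.1 p.2 - θ p.2) +
      fun p => μ * (φ k p.1 p.2 / r φ k p.1 * ξ (k + 1) p.1) := by
  have hz : ∀ (est : Fin n → EuclideanSpace ℝ (Fin m)) (j : Fin n) (a : Fin m),
      z 𝒩 φ Q k est j a = x 𝒩 φ k Q j * (𝒩.laplacian *ᵥ fun l => est l a) j := by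
    intro est j a
    have h : ∑ l ∈ 𝒩.nbrs j, 𝒩.weight l j • (est j - est l) =
        est j - ∑ l, 𝒩.weight j l • est l := by
      rw [← 𝒩.sum_weight_smul_sub]
      exact Finset.sum_congr rfl fun l _ => by rw [𝒩.symm.apply]
    rw [z, h, 𝒩.laplacian_mulVec]
    simp
  -- The Laplacian annihilates constants, so `θ` drops out of the consensus term.
  have hlap : ∀ (u : Fin n → ℝ) (c : ℝ),
      (𝒩.laplacian *ᵥ fun l => u l - c) = 𝒩.laplacian *ᵥ u := by
    intro u c
    ext j
    simp only [𝒩.laplacian_mulVec, mul_sub, Finset.sum_sub_distrib, ← Finset.sum_mul, 𝒩.row_sum]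
    ring
  ext ⟨i, a⟩
  simp only [Pi.add_apply, Matrix.sub_mulVec, Matrix.one_mulVec, Pi.sub_apply, Matrix.smul_mulVec,
    Pi.smul_apply, smul_eq_mul, G_mulVec, A_mulVec, hlap]
  simp only [estimate]
  set est := estimate 𝒩 φ Q μ ν y θ₀ k
  rw [𝒩.sum_weight_smul_sub i (z 𝒩 φ Q k est)]
  have h1 : (z 𝒩 φ Q k est i - ∑ j, 𝒩.weight i j • z 𝒩 φ Q k est j) a =
      (𝒩.laplacian *ᵥ fun j => x 𝒩 φ k Q j * (𝒩.laplacian *ᵥ fun l => est l a) j) i := by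
    rw [𝒩.laplacian_mulVec]
    simp [hz]
  have h2 : y (k + 1) i - inner ℝ (φ k i) (est i) =
      ξ (k + 1) i - ∑ b, φ k i b * (est i b - θ b) := by
    rw [hy, real_inner_comm, ← sub_eq_zero]
    simp only [PiLp.inner_apply, RCLike.inner_apply, conj_trivial, mul_sub, Finset.sum_sub_distrib]
    simp only [mul_comm]
    ring
  rw [PiLp.sub_apply, PiLp.add_apply, PiLp.smul_apply, PiLp.smul_apply, h1, h2]
  simp only [smul_eq_mul]
  ring

variable {Q : ℕ} {μ ν τ : ℝ}

/-- A quantity below both `1` and `x` is below `x ^ s`. This spends only part of the decay of `Ψ`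
and keeps the growth in `ρ j` small enough for the noise to absorb. -/
lemma norm_Psi_mul_Psi_inv_le (hμ : 0 ≤ μ) (hν : 0 ≤ ν) (hμν : μ * (1 + 4 * ν) ≤ 1)
    (h0 : (1 - μ • G 𝒩 φ Q ν 0).det ≠ 0) (hdet : DetBound 𝒩 φ Q μ ν τ) (hτ : 0 ≤ τ)
    {ρ : ℕ → ℝ} (hρ : ∀ k i, r φ k i ≤ ρ k) (hρ0 : ∀ k, 0 ≤ ρ k) {s : ℝ} (hs0 : 0 ≤ s)
    (hs1 : s ≤ 1) {j K : ℕ} (hjK : j < K) :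
    ‖Psi 𝒩 φ Q μ ν K * (Psi 𝒩 φ Q μ ν (j + 1))⁻¹‖ ≤
      ‖Psi 𝒩 φ Q μ ν K‖ ^ s * ‖(Psi 𝒩 φ Q μ ν 1)⁻¹‖ ^ s * ρ j ^ (n * τ * s) := by
  have h1 : ‖Psi 𝒩 φ Q μ ν K * (Psi 𝒩 φ Q μ ν (j + 1))⁻¹‖ ≤
      ‖Psi 𝒩 φ Q μ ν K‖ * ‖(Psi 𝒩 φ Q μ ν 1)⁻¹‖ * ρ j ^ (n * τ) := by
    refine (norm_mul_le _ _).trans ?_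
    rw [mul_assoc]
    refine mul_le_mul_of_nonneg_left ((norm_Psi_inv_le 𝒩 φ hμ hν hμν hdet j).trans ?_)
      (norm_nonneg _)
    refine mul_le_mul_of_nonneg_left ?_ (norm_nonneg _)
    rw [Real.rpow_mul (hρ0 j), Real.rpow_natCast]
    refine Real.rpow_le_rpow (Finset.prod_nonneg fun i _ => (r_pos φ j i).le) ?_ hτ
    calc _ ≤ ∏ _i : Fin n, ρ j :=
          Finset.prod_le_prod (fun i _ => (r_pos φ j i).le) fun i _ => hρ j i
      _ = _ := by simp
  refine (le_rpow_of_le_one_of_le (norm_nonneg _)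
    (norm_Psi_mul_Psi_inv_le_one 𝒩 φ hμ hν hμν h0 hdet hjK) h1 hs0 hs1).trans_eq ?_
  rw [Real.mul_rpow (by positivity) (Real.rpow_nonneg (hρ0 j) _),
    Real.mul_rpow (by positivity) (by positivity), ← Real.rpow_mul (hρ0 j)]

/-- Only the factor at time `0` may expand; all later ones are contractions. -/
lemma exists_norm_Psi_le (hμ : 0 ≤ μ) (hν : 0 ≤ ν) (hμν : μ * (1 + 4 * ν) ≤ 1) :
    ∃ C : ℝ, 1 ≤ C ∧ ∀ k, ‖Psi 𝒩 φ Q μ ν k‖ ≤ C := by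
  refine ⟨max (max 1 ‖Psi 𝒩 φ Q μ ν 0‖) ‖Psi 𝒩 φ Q μ ν 1‖,
    (le_max_left _ _).trans (le_max_left _ _), fun k => ?_⟩
  induction k with
  | zero => exact (le_max_right _ _).trans (le_max_left _ _)
  | succ k ih =>
    cases k with
    | zero => exact le_max_right _ _
    | succ k =>
      rw [Psi]
      exact (norm_mul_le _ _).trans ((mul_le_of_le_one_left (norm_nonneg _)
        (norm_one_sub_G_le 𝒩 φ hμ hν hμν k)).trans ih)

lemma norm_G_le_sum (hν : 0 ≤ ν) (k : ℕ) :
    ‖G 𝒩 φ Q ν k‖ ≤ (1 + 4 * ν) * ∑ i, ‖φ k i‖ ^ 2 / r φ k i :=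
  norm_G_le 𝒩 φ hν (Finset.sum_nonneg fun i _ => x_zero_nonneg 𝒩 φ k i) fun i =>
    Finset.single_le_sum (f := fun i => x 𝒩 φ k 0 i) (fun i _ => x_zero_nonneg 𝒩 φ k i)
      (Finset.mem_univ i)

/-- The accumulated noise `∑_{j < k} Φ_j R_j⁻¹ Ξ_{j+1}`. -/
noncomputable def noiseSum (ξ : ℕ → Fin n → ℝ) (k : ℕ) (p : Fin n × Fin m) : ℝ :=
  ∑ j ∈ Finset.range k, φ j p.1 p.2 / r φ j p.1 * ξ (j + 1) p.1

/-- Write `r⁻¹ = r^(-δ) * r^(δ-1)` and apply Abel's inequality with the decreasing weights `r^(-δ)`;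
`γ` converts each sensor's `r` to the common `ρ`. -/
lemma norm_noiseSum_sub_le {ρ : ℕ → ℝ} {γ : ℝ} (hγ0 : 0 < γ) (hρ0 : ∀ k, 0 < ρ k)
    (hγ : ∀ k i, ρ k ≤ γ * r φ k i) (ξ : ℕ → Fin n → ℝ) {δ B : ℝ} (hδ : 0 < δ)
    (hB : ∀ i a k, |∑ j ∈ Finset.range k, r φ j i ^ (δ - 1) * φ j i a * ξ (j + 1) i| ≤ B)
    {j K : ℕ} (hjK : j ≤ K) :
    ‖WithLp.toLp 2 (noiseSum φ ξ K - noiseSum φ ξ j)‖ ≤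
      √(Fintype.card (Fin n × Fin m)) * (2 * |B| * γ ^ δ) * ρ j ^ (-δ) := by
  -- The sign of `B` is known only if an index exists, hence `|B|` in the constant.
  have hB0 : ∀ _ : Fin n × Fin m, 0 ≤ B := fun p => by simpa using hB p.1 p.2 0
  rw [mul_assoc]
  have h0 : 0 ≤ 2 * |B| * γ ^ δ * ρ j ^ (-δ) := by
    have := hρ0 j
    positivity
  refine norm_toLp_le h0 fun p => ?_
  have hsum : (noiseSum φ ξ K - noiseSum φ ξ j) p = ∑ l ∈ Finset.Ico j K, r φ l p.1 ^ (-δ) *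
      ((∑ q ∈ Finset.range (l + 1), r φ q p.1 ^ (δ - 1) * φ q p.1 p.2 * ξ (q + 1) p.1) -
        ∑ q ∈ Finset.range l, r φ q p.1 ^ (δ - 1) * φ q p.1 p.2 * ξ (q + 1) p.1) := by
    rw [Pi.sub_apply, noiseSum, noiseSum, ← Finset.sum_Ico_eq_sub _ hjK]
    refine Finset.sum_congr rfl fun l _ => ?_
    rw [Finset.sum_range_succ, add_sub_cancel_left, ← mul_assoc, ← mul_assoc,
      ← Real.rpow_add (r_pos φ l p.1), show -δ + (δ - 1) = -1 by ring, Real.rpow_neg_one]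
    ring
  rw [hsum]
  refine (abs_sum_Ico_mul_sub_le (b := fun l => r φ l p.1 ^ (-δ)) (hB p.1 p.2) ?_
    (fun k => (Real.rpow_pos_of_pos (r_pos φ k p.1) _).le) hjK).trans ?_
  · intro k l hkl
    exact Real.rpow_le_rpow_of_nonpos (r_pos φ k p.1) (r_mono φ p.1 hkl) (by linarith)
  · rw [abs_of_nonneg (hB0 p), mul_assoc]
    have h2 : 0 ≤ 2 * B := mul_nonneg zero_le_two (hB0 p)
    rw [mul_assoc, ← mul_assoc]
    refine mul_le_mul_of_nonneg_left ?_ h2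
    calc r φ j p.1 ^ (-δ) ≤ (ρ j / γ) ^ (-δ) :=
          Real.rpow_le_rpow_of_nonpos (div_pos (hρ0 j) hγ0)
            (by rw [div_le_iff₀' hγ0]; exact hγ j p.1) (by linarith)
      _ = γ ^ δ * ρ j ^ (-δ) := by
        rw [Real.div_rpow (hρ0 j).le hγ0.le, Real.rpow_neg hγ0.le, div_inv_eq_mul, mul_comm]

/-- The error, corrected by the noise up to a fixed time `K`, obeys a linear recursion driven by
`G_k` alone. -/
lemma corrected_error_succ (Q : ℕ) (μ ν : ℝ) (θ : EuclideanSpace ℝ (Fin m)) (y ξ : ℕ → Fin n → ℝ)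
    (hy : ∀ k i, y (k + 1) i = inner ℝ θ (φ k i) + ξ (k + 1) i)
    (θ₀ : Fin n → EuclideanSpace ℝ (Fin m)) (K k : ℕ) :
    (fun p : Fin n × Fin m => estimate 𝒩 φ Q μ ν y θ₀ (k + 1) p.1 p.2 - θ p.2) +
        μ • (noiseSum φ ξ K - noiseSum φ ξ (k + 1)) =
      (1 - μ • G 𝒩 φ Q ν k) *ᵥ ((fun p => estimate 𝒩 φ Q μ ν y θ₀ k p.1 p.2 - θ p.2) +
        μ • (noiseSum φ ξ K - noiseSum φ ξ k)) +
      (μ ^ 2) • (G 𝒩 φ Q ν k *ᵥ (noiseSum φ ξ K - noiseSum φ ξ k)) := by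
  have hU : noiseSum φ ξ (k + 1) =
      noiseSum φ ξ k + fun p => φ k p.1 p.2 / r φ k p.1 * ξ (k + 1) p.1 := by
    ext p
    simp [noiseSum, Finset.sum_range_succ]
  rw [error_succ 𝒩 φ Q μ ν θ y ξ hy θ₀ k, Matrix.mulVec_add, Matrix.mulVec_smul,
    Matrix.sub_mulVec _ _ (noiseSum φ ξ K - noiseSum φ ξ k), Matrix.one_mulVec,
    Matrix.smul_mulVec, hU]
  ext p
  simp only [Pi.add_apply, Pi.sub_apply, Pi.smul_apply, smul_eq_mul]
  ring

set_option maxHeartbeats 1000000 in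
/-- The convergence rate on a path on which the weighted noise sums are bounded. -/
theorem exists_error_le (hn : 0 < n) (hμ : 0 ≤ μ) (hν : 0 ≤ ν) (hμν : μ * (1 + 4 * ν) ≤ 1)
    (h0 : (1 - μ • G 𝒩 φ Q ν 0).det ≠ 0) (hdet : DetBound 𝒩 φ Q μ ν τ) (hτ : 1 ≤ τ)
    {ρ : ℕ → ℝ} {γ : ℝ} (hρ : ∀ k i, r φ k i ≤ ρ k) (hγ : ∀ k i, ρ k ≤ γ * r φ k i)
    (θ : EuclideanSpace ℝ (Fin m)) (y ξ : ℕ → Fin n → ℝ)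
    (hy : ∀ k i, y (k + 1) i = inner ℝ θ (φ k i) + ξ (k + 1) i)
    (θ₀ : Fin n → EuclideanSpace ℝ (Fin m)) {δ B : ℝ} (hδ : 0 < δ)
    (hB : ∀ i a k, |∑ j ∈ Finset.range k, r φ j i ^ (δ - 1) * φ j i a * ξ (j + 1) i| ≤ B) :
    ∃ M : ℝ, 0 < M ∧ ∀ k,
      ‖stack (estimate 𝒩 φ Q μ ν y θ₀ k) - stack (fun _ => θ)‖
        ≤ M * ‖Psi 𝒩 φ Q μ ν k‖ ^ (δ / (n * τ * (1 + δ))) := by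
  have hn1 : (1 : ℝ) ≤ n := by exact_mod_cast hn
  have hnτ : 1 ≤ n * τ := one_le_mul_of_one_le_of_one_le hn1 hτ
  set s : ℝ := δ / (n * τ * (1 + δ)) with hs
  have hs0 : 0 ≤ s := by positivity
  have hs1 : s ≤ 1 := by
    rw [hs, div_le_one (by positivity)]
    nlinarith
  have hρ1 : ∀ k, 1 ≤ ρ k := fun k => (one_le_r φ k ⟨0, hn⟩).trans (hρ k _)
  have hρ0 : ∀ k, 0 < ρ k := fun k => one_pos.trans_le (hρ1 k)
  have hγ0 : 0 < γ := by
    have := (hρ0 0).trans_le (hγ 0 ⟨0, hn⟩)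
    exact pos_of_mul_pos_left this (r_pos φ 0 _).le
  -- Here `η = δ - δ/(1+δ) = δ²/(1+δ)`: the noise decay left after paying for the growth of
  -- `Ψ(j+1)⁻¹`.
  set η : ℝ := δ - n * τ * s with hη
  have hη0 : 0 < η := by
    have : n * τ * s = δ / (1 + δ) := by rw [hs]; field_simp
    rw [hη, this, sub_pos, div_lt_iff₀ (by positivity)]
    nlinarith
  let U : ℕ → Fin n × Fin m → ℝ := noiseSum φ ξ
  set c : ℝ := √(Fintype.card (Fin n × Fin m)) * (2 * |B| * γ ^ δ) with hc
  have hc0 : 0 ≤ c := by positivity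
  have hD : ∀ {j K}, j ≤ K → ‖WithLp.toLp 2 (U K - U j)‖ ≤ c * ρ j ^ (-δ) := fun hjK =>
    norm_noiseSum_sub_le φ hγ0 hρ0 hγ ξ hδ hB hjK
  obtain ⟨C, hC1, hC⟩ := exists_norm_Psi_le 𝒩 φ (Q := Q) hμ hν hμν
  let e : ℕ → Fin n × Fin m → ℝ := fun k p => estimate 𝒩 φ Q μ ν y θ₀ k p.1 p.2 - θ p.2
  set F : ℝ := ‖WithLp.toLp 2 (e 0)‖ + μ * c with hF
  have hF0 : 0 ≤ F := by positivity
  set C₀ : ℝ := ‖(Psi 𝒩 φ Q μ ν 1)⁻¹‖ ^ s with hC₀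
  have hC₀0 : 0 ≤ C₀ := by positivity
  set T : ℝ := ∑ i, (‖φ 0 i‖ ^ 2 + 1 / η) with hT
  have hT0 : 0 ≤ T := Finset.sum_nonneg fun i _ => by positivity
  refine ⟨C * F + μ ^ 2 * ((1 + 4 * ν) * (C₀ * c)) * T + 1, by positivity, fun K => ?_⟩
  set p : ℝ := ‖Psi 𝒩 φ Q μ ν K‖ with hp
  have hp0 : 0 ≤ p := norm_nonneg _
  have hps : 0 ≤ p ^ s := Real.rpow_nonneg hp0 s
  -- the error corrected by the noise still to come obeys a recursion with a summable input
  let f : ℕ → Fin n × Fin m → ℝ := fun k => e k + μ • (U K - U k)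
  have hf : ∀ k, f (k + 1) = (1 - μ • G 𝒩 φ Q ν k) *ᵥ f k +
      (μ ^ 2) • (G 𝒩 φ Q ν k *ᵥ (U K - U k)) :=
    corrected_error_succ 𝒩 φ Q μ ν θ y ξ hy θ₀ K
  have hfK := eq_transition_add_sum (Ψ := Psi 𝒩 φ Q μ ν) rfl (fun _ => rfl)
    (det_Psi_ne_zero 𝒩 φ h0 hdet) hf K
  -- At the terminal time no noise remains, so the correction vanishes.
  have hfe : f K = e K := by simp [f]
  have hlead : ‖WithLp.toLp 2 (Psi 𝒩 φ Q μ ν K *ᵥ f 0)‖ ≤ C * F * p ^ s := by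
    have h1 : ‖WithLp.toLp 2 (f 0)‖ ≤ F := by
      refine (norm_add_le (WithLp.toLp 2 (e 0)) (μ • WithLp.toLp 2 (U K - U 0))).trans ?_
      rw [hF, norm_smul, Real.norm_of_nonneg hμ]
      refine add_le_add_right (mul_le_mul_of_nonneg_left ((hD K.zero_le).trans ?_) hμ) _
      exact mul_le_of_le_one_right hc0
        (Real.rpow_le_one_of_one_le_of_nonpos (hρ1 0) (by linarith))
    -- `p` may exceed `1`, so the interpolation is applied to `p / C ≤ 1`.
    have h2 : p ≤ C * p ^ s := by
      have hC0 : 0 < C := one_pos.trans_le hC1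
      have h : p / C ≤ p ^ s := le_rpow_of_le_one_of_le (by positivity)
        ((div_le_one hC0).2 (hC K)) (div_le_self hp0 hC1) hs0 hs1
      rwa [div_le_iff₀' hC0] at h
    refine (Matrix.l2_opNorm_mulVec _ (WithLp.toLp 2 (f 0))).trans ?_
    calc _ ≤ (C * p ^ s) * F := mul_le_mul h2 h1 (norm_nonneg _) (by positivity)
      _ = _ := by ring
  have hterm : ∀ j ∈ Finset.range K, ‖WithLp.toLp 2 ((Psi 𝒩 φ Q μ ν K *
      (Psi 𝒩 φ Q μ ν (j + 1))⁻¹) *ᵥ ((μ ^ 2) • (G 𝒩 φ Q ν j *ᵥ (U K - U j))))‖ ≤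
      (p ^ s * μ ^ 2 * ((1 + 4 * ν) * (C₀ * c))) *
        ∑ i, ‖φ j i‖ ^ 2 / r φ j i ^ (1 + η) := by
    intro j hj
    have hj' := Finset.mem_range.1 hj
    have h1 := norm_Psi_mul_Psi_inv_le 𝒩 φ hμ hν hμν h0 hdet (by linarith) hρ
      (fun k => (hρ0 k).le) hs0 hs1 hj'
    have h2 : ‖WithLp.toLp 2 ((μ ^ 2) • (G 𝒩 φ Q ν j *ᵥ (U K - U j)))‖ ≤
        μ ^ 2 * (((1 + 4 * ν) * ∑ i, ‖φ j i‖ ^ 2 / r φ j i) * (c * ρ j ^ (-δ))) := by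
      rw [WithLp.toLp_smul, norm_smul, Real.norm_of_nonneg (sq_nonneg μ)]
      refine mul_le_mul_of_nonneg_left ?_ (sq_nonneg μ)
      refine (Matrix.l2_opNorm_mulVec _ (WithLp.toLp 2 (U K - U j))).trans ?_
      exact mul_le_mul (norm_G_le_sum 𝒩 φ hν j) (hD hj'.le) (norm_nonneg _)
        ((norm_nonneg _).trans (norm_G_le_sum 𝒩 φ (Q := Q) hν j))
    have h3 : (∑ i, ‖φ j i‖ ^ 2 / r φ j i) * (ρ j ^ (n * τ * s) * ρ j ^ (-δ)) ≤
        ∑ i, ‖φ j i‖ ^ 2 / r φ j i ^ (1 + η) := by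
      rw [← Real.rpow_add (hρ0 j), show n * τ * s + -δ = -η by rw [hη]; ring, Finset.sum_mul]
      refine Finset.sum_le_sum fun i _ => ?_
      rw [Real.rpow_add (r_pos φ j i), Real.rpow_one, ← div_div, div_eq_mul_inv _ (r φ j i ^ η),
        ← Real.rpow_neg (r_pos φ j i).le]
      exact mul_le_mul_of_nonneg_left (Real.rpow_le_rpow_of_nonpos (r_pos φ j i) (hρ j i)
        (by linarith)) (div_nonneg (by positivity) (r_pos φ j i).le)
    refine (Matrix.l2_opNorm_mulVec _
      (WithLp.toLp 2 ((μ ^ 2) • (G 𝒩 φ Q ν j *ᵥ (U K - U j))))).trans ?_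
    calc _ ≤ (p ^ s * C₀ * ρ j ^ (n * τ * s)) *
          (μ ^ 2 * (((1 + 4 * ν) * ∑ i, ‖φ j i‖ ^ 2 / r φ j i) * (c * ρ j ^ (-δ)))) :=
          mul_le_mul h1 h2 (norm_nonneg _) ((norm_nonneg _).trans h1)
      _ = (p ^ s * μ ^ 2 * ((1 + 4 * ν) * (C₀ * c))) *
          ((∑ i, ‖φ j i‖ ^ 2 / r φ j i) * (ρ j ^ (n * τ * s) * ρ j ^ (-δ))) := by ring
      _ ≤ _ := mul_le_mul_of_nonneg_left h3 (by positivity)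
  have hsum : ∑ j ∈ Finset.range K, ∑ i, ‖φ j i‖ ^ 2 / r φ j i ^ (1 + η) ≤ T := by
    rw [Finset.sum_comm]
    exact Finset.sum_le_sum fun i _ => sum_sq_div_r_rpow_le φ hη0 i K
  have heK : stack (estimate 𝒩 φ Q μ ν y θ₀ K) - stack (fun _ => θ) = WithLp.toLp 2 (e K) := rfl
  rw [heK, ← hfe, hfK, WithLp.toLp_add, WithLp.toLp_sum]
  calc _ ≤ C * F * p ^ s + ∑ j ∈ Finset.range K, (p ^ s * μ ^ 2 * ((1 + 4 * ν) * (C₀ * c))) *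
        ∑ i, ‖φ j i‖ ^ 2 / r φ j i ^ (1 + η) :=
        (norm_add_le _ _).trans (add_le_add hlead ((norm_sum_le _ _).trans
          (Finset.sum_le_sum hterm)))
    _ ≤ C * F * p ^ s + (p ^ s * μ ^ 2 * ((1 + 4 * ν) * (C₀ * c))) * T := by
      rw [← Finset.mul_sum]
      exact add_le_add_right (mul_le_mul_of_nonneg_left hsum (by positivity)) _
    _ ≤ _ := by nlinarith

end Path

/-! ### Convergence of martingale transforms with finite predictable variation -/

section Martingale

open scoped ENNReal

variable {Ω : Type*}

/-- Pull-out property of the conditional Lebesgue expectation under the integral. -/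
lemma lintegral_mul_condLExp {m' m₀ : MeasurableSpace Ω} {P : Measure Ω} (hm : m' ≤ m₀)
    [IsFiniteMeasure P]
    {g X : Ω → ℝ≥0∞} (hg : Measurable[m'] g) (hX : Measurable X) :
    ∫⁻ ω, g ω * condLExp m' P X ω ∂P = ∫⁻ ω, g ω * X ω ∂P := by
  have hY : Measurable (condLExp m' P X) := measurable_condLExp' m' P X
  -- The two densities have equal integrals over `m'`-sets, and an `m'`-measurable `g` sees only the
  -- trimmed measures.
  have htrim : (P.withDensity (condLExp m' P X)).trim hm = (P.withDensity X).trim hm := by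
    refine @Measure.ext _ m' _ _ fun s hs => ?_
    rw [trim_measurableSet_eq hm hs, trim_measurableSet_eq hm hs, withDensity_apply _ (hm s hs),
      withDensity_apply _ (hm s hs), setLIntegral_condLExp hm P X hs]
  have h : ∀ Z : Ω → ℝ≥0∞, Measurable Z →
      ∫⁻ ω, g ω * Z ω ∂P = ∫⁻ ω, g ω ∂((P.withDensity Z).trim hm) := fun Z hZ => by
    rw [lintegral_trim hm hg, lintegral_withDensity_eq_lintegral_mul _ hZ (hg.mono hm le_rfl)]
    exact lintegral_congr fun ω => mul_comm _ _
  rw [h _ hY, h _ hX, htrim]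

variable {m₀ : MeasurableSpace Ω} {P : Measure Ω} [IsProbabilityMeasure P]
  {ℱ : Filtration ℕ m₀} {X w : ℕ → Ω → ℝ}

/-- A martingale transform whose predictable quadratic variation is bounded converges. -/
lemma ae_tendsto_of_condVar_bounded (hX : ∀ k, Measurable[ℱ (k + 1)] (X (k + 1)))
    (hXint : ∀ k, Integrable (X (k + 1)) P) (hX0 : ∀ k, P[X (k + 1) | ℱ k] =ᵐ[P] 0)
    (hw : ∀ k, Measurable[ℱ k] (w k)) {a : ℝ≥0∞} (ha : a ≠ ∞)
    (hV : ∀ k ω, ∑ j ∈ Finset.range k,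
      ‖w j ω‖ₑ ^ 2 * condLExp (ℱ j) P (fun ω' => ‖X (j + 1) ω'‖ₑ ^ 2) ω ≤ a) :
    ∀ᵐ ω ∂P, ∃ c, Tendsto (fun k => ∑ j ∈ Finset.range k, w j ω * X (j + 1) ω) atTop (𝓝 c) := by
  have hw' : ∀ k, Measurable (w k) := fun k => (hw k).mono (ℱ.le k) le_rfl
  have hX' : ∀ k, Measurable (X (k + 1)) := fun k => (hX k).mono (ℱ.le _) le_rfl
  let d : ℕ → Ω → ℝ := fun j => w j * X (j + 1)
  let M : ℕ → Ω → ℝ := fun k ω => ∑ j ∈ Finset.range k, w j ω * X (j + 1) ω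
  have hMsucc : ∀ k, M (k + 1) = M k + d k := fun k => by
    ext ω
    simp [M, d, Finset.sum_range_succ]
  have hdm : ∀ k, Measurable (d k) := fun k => (hw' k).mul (hX' k)
  have hd2 : ∀ k, ∫⁻ ω, ‖d k ω‖ₑ ^ 2 ∂P = ∫⁻ ω, ‖w k ω‖ₑ ^ 2 *
      condLExp (ℱ k) P (fun ω' => ‖X (k + 1) ω'‖ₑ ^ 2) ω ∂P := fun k => by
    refine Eq.trans ?_ (lintegral_mul_condLExp (ℱ.le k)
      ((measurable_enorm.pow_const 2).comp (hw k)) ((hX' k).enorm.pow_const 2)).symm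
    exact lintegral_congr fun ω => by simp [d, enorm_mul, mul_pow]
  have hsum : ∀ k, ∑ j ∈ Finset.range k, ∫⁻ ω, ‖d j ω‖ₑ ^ 2 ∂P ≤ a := fun k => by
    simp only [hd2]
    calc _ = _ := (lintegral_finsetSum _ fun j _ =>
          ((hw' j).enorm.pow_const 2).mul (measurable_condLExp' _ _ _)).symm
      _ ≤ ∫⁻ _, a ∂P := lintegral_mono fun ω => hV k ω
      _ = a := by simp
  have hdL : ∀ k, MemLp (d k) 2 P := fun k => by
    refine ⟨(hdm k).aestronglyMeasurable, ?_⟩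
    rw [eLpNorm_lt_top_iff_lintegral_rpow_enorm_lt_top two_ne_zero ENNReal.ofNat_ne_top]
    have h := (Finset.single_le_sum (f := fun j => ∫⁻ ω, ‖d j ω‖ₑ ^ 2 ∂P)
      (fun _ _ => zero_le) (Finset.self_mem_range_succ k)).trans (hsum (k + 1))
    simpa using h.trans_lt ha.lt_top
  have hML : ∀ k, MemLp (M k) 2 P := fun k => by
    induction k with
    | zero => simp [M]
    | succ k ih => rw [hMsucc]; exact ih.add (hdL k)
  have hMad : StronglyAdapted ℱ M := fun k => by
    refine Measurable.stronglyMeasurable ?_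
    refine Finset.measurable_sum _ fun j hj => ?_
    have hj' := Finset.mem_range.1 hj
    exact ((hw j).mono (ℱ.mono hj'.le) le_rfl).mul ((hX j).mono (ℱ.mono hj') le_rfl)
  have hmart : Martingale M ℱ P := by
    refine martingale_of_condExp_sub_eq_zero_nat hMad
      (fun k => (hML k).integrable one_le_two) fun k => ?_
    rw [hMsucc, add_sub_cancel_left]
    filter_upwards [condExp_mul_of_stronglyMeasurable_left (hw k).stronglyMeasurable
      ((hdL k).integrable one_le_two) (hXint k), hX0 k] with ω h1 h2
    simp [d, h1, h2]
  -- Orthogonality of increments: `M k * w k` is known at time `k` and `X (k + 1)` has conditional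
  -- mean zero.
  have hcross : ∀ k, ∫ ω, M k ω * d k ω ∂P = 0 := fun k => by
    have hint : Integrable ((M k * w k) * X (k + 1)) P := by
      have := (hML k).integrable_mul (hdL k)
      rwa [mul_assoc]
    have h := condExp_mul_of_stronglyMeasurable_left
      ((hMad k).mul (hw k).stronglyMeasurable) hint (hXint k)
    calc _ = ∫ ω, ((M k * w k) * X (k + 1)) ω ∂P :=
          integral_congr_ae (ae_of_all _ fun ω => (mul_assoc _ _ _).symm)
      _ = ∫ ω, (P[(M k * w k) * X (k + 1) | ℱ k]) ω ∂P := (integral_condExp (ℱ.le k)).symm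
      _ = ∫ ω, (0 : ℝ) ∂P := by
        refine integral_congr_ae ?_
        filter_upwards [h, hX0 k] with ω h1 h2
        simp [h1, h2]
      _ = 0 := by simp
  have hMsq : ∀ k, ∫ ω, M k ω ^ 2 ∂P = ∑ j ∈ Finset.range k, ∫ ω, d j ω ^ 2 ∂P := fun k => by
    induction k with
    | zero => simp [M]
    | succ k ih =>
      rw [Finset.sum_range_succ, ← ih, hMsucc]
      have hi1 := (hML k).integrable_sq
      have hi2 : Integrable (fun ω => M k ω * d k ω) P := (hML k).integrable_mul (hdL k)
      have hi12 : Integrable (fun ω => M k ω ^ 2 + 2 * (M k ω * d k ω)) P :=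
        hi1.add (hi2.const_mul 2)
      have hi3 := (hdL k).integrable_sq
      calc _ = ∫ ω, (M k ω ^ 2 + 2 * (M k ω * d k ω)) + d k ω ^ 2 ∂P :=
            integral_congr_ae (ae_of_all _ fun ω => by simp only [Pi.add_apply]; ring)
        _ = _ := by
          rw [integral_add hi12 hi3, integral_add hi1 (hi2.const_mul 2),
            integral_const_mul, hcross, mul_zero, add_zero]
  have hMle : ∀ k, ∫ ω, M k ω ^ 2 ∂P ≤ a.toReal := fun k => by
    rw [hMsq]
    have h : ∀ j, ∫ ω, d j ω ^ 2 ∂P = (∫⁻ ω, ‖d j ω‖ₑ ^ 2 ∂P).toReal := fun j => by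
      rw [integral_eq_lintegral_of_nonneg_ae (ae_of_all _ fun ω => sq_nonneg _)
        ((hdm j).pow_const 2).aestronglyMeasurable]
      congr 1
      refine lintegral_congr fun ω => ?_
      rw [← enorm_pow, Real.enorm_of_nonneg (sq_nonneg _)]
    simp only [h]
    rw [← ENNReal.toReal_sum fun j _ => ?_]
    · exact ENNReal.toReal_mono ha (hsum k)
    · exact ne_top_of_le_ne_top ha ((Finset.single_le_sum
        (f := fun j => ∫⁻ ω, ‖d j ω‖ₑ ^ 2 ∂P) (fun _ _ => zero_le)
        (Finset.self_mem_range_succ j)).trans (hsum (j + 1)))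
  refine hmart.submartingale.exists_ae_tendsto_of_bdd (R := (1 + a.toReal).toNNReal) fun k => ?_
  rw [eLpNorm_one_eq_lintegral_enorm,
    ← ofReal_integral_norm_eq_lintegral_enorm ((hML k).integrable one_le_two)]
  refine ENNReal.ofReal_le_ofReal ?_
  -- The `L²` bound gives the `L¹` bound required by the convergence theorem.
  calc ∫ ω, ‖M k ω‖ ∂P ≤ ∫ ω, 1 + M k ω ^ 2 ∂P := by
        refine integral_mono ((hML k).integrable one_le_two).norm
          ((integrable_const _).add (hML k).integrable_sq) fun ω => ?_
        simp only [Real.norm_eq_abs]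
        nlinarith [sq_abs (M k ω), sq_nonneg (|M k ω| - 1)]
    _ ≤ 1 + a.toReal := by
      rw [integral_add (integrable_const _) (hML k).integrable_sq]
      simpa using hMle k

/-- A martingale transform converges almost surely where its predictable quadratic variation is
finite. -/
lemma ae_tendsto_of_condVar (hX : ∀ k, Measurable[ℱ (k + 1)] (X (k + 1)))
    (hXint : ∀ k, Integrable (X (k + 1)) P) (hX0 : ∀ k, P[X (k + 1) | ℱ k] =ᵐ[P] 0)
    (hw : ∀ k, Measurable[ℱ k] (w k)) :
    ∀ᵐ ω ∂P, (∃ a : ℝ≥0∞, a ≠ ∞ ∧ ∀ k, ∑ j ∈ Finset.range k,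
      ‖w j ω‖ₑ ^ 2 * condLExp (ℱ j) P (fun ω' => ‖X (j + 1) ω'‖ₑ ^ 2) ω ≤ a) →
    ∃ c, Tendsto (fun k => ∑ j ∈ Finset.range k, w j ω * X (j + 1) ω) atTop (𝓝 c) := by
  let V : ℕ → Ω → ℝ≥0∞ := fun k ω => ∑ j ∈ Finset.range k,
    ‖w j ω‖ₑ ^ 2 * condLExp (ℱ j) P (fun ω' => ‖X (j + 1) ω'‖ₑ ^ 2) ω
  have hV : ∀ k, Measurable[ℱ k] (V (k + 1)) := fun k => by
    refine Finset.measurable_sum _ fun j hj => ?_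
    have hj' : j ≤ k := Nat.lt_succ_iff.1 (Finset.mem_range.1 hj)
    exact (((measurable_enorm.pow_const 2).comp (hw j)).mul (measurable_condLExp (ℱ j) P _)).mono
      (ℱ.mono hj') le_rfl
  -- Localization: `V (k + 1)` is already known at time `k`, so cutting off at level `a` keeps the
  -- weights predictable and bounds the variation by `a`.
  let u : ℕ → ℕ → Ω → ℝ := fun a k => {ω | V (k + 1) ω ≤ a}.indicator (w k)
  have hu : ∀ a k, Measurable[ℱ k] (u a k) := fun a k =>
    (hw k).indicator (measurableSet_le (hV k) measurable_const)
  have hbd : ∀ (a k : ℕ) ω, ∑ j ∈ Finset.range k,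
      ‖u a j ω‖ₑ ^ 2 * condLExp (ℱ j) P (fun ω' => ‖X (j + 1) ω'‖ₑ ^ 2) ω ≤ min (V k ω) a := by
    intro a k ω
    induction k with
    | zero => simp
    | succ k ih =>
      rw [Finset.sum_range_succ]
      have hVs : V (k + 1) ω = V k ω +
          ‖w k ω‖ₑ ^ 2 * condLExp (ℱ k) P (fun ω' => ‖X (k + 1) ω'‖ₑ ^ 2) ω :=
        Finset.sum_range_succ _ _
      by_cases h : V (k + 1) ω ≤ a
      · have hw : u a k ω = w k ω := Set.indicator_of_mem (s := {ω | V (k + 1) ω ≤ a}) h _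
        rw [hw, min_eq_left h, hVs]
        gcongr
        exact ih.trans (min_le_left _ _)
      · have hw : u a k ω = 0 := Set.indicator_of_notMem (s := {ω | V (k + 1) ω ≤ a}) h _
        rw [hw]
        simp only [enorm_zero, ne_eq, OfNat.ofNat_ne_zero, not_false_eq_true, zero_pow, zero_mul,
          add_zero]
        refine ih.trans (min_le_min_right _ ?_)
        rw [hVs]
        exact le_self_add
  have hall : ∀ᵐ ω ∂P, ∀ a : ℕ, ∃ c,
      Tendsto (fun k => ∑ j ∈ Finset.range k, u a j ω * X (j + 1) ω) atTop (𝓝 c) :=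
    ae_all_iff.2 fun a => ae_tendsto_of_condVar_bounded hX hXint hX0 (hu a)
      (ENNReal.natCast_ne_top a) fun k ω => (hbd a k ω).trans (min_le_right _ _)
  filter_upwards [hall] with ω hω
  rintro ⟨b, hb, hbV⟩
  obtain ⟨a, hab⟩ := ENNReal.exists_nat_gt hb
  obtain ⟨c, hc⟩ := hω a
  refine ⟨c, hc.congr fun k => Finset.sum_congr rfl fun j _ => ?_⟩
  have : u a j ω = w j ω := Set.indicator_of_mem (s := {ω | V (j + 1) ω ≤ a})
    ((hbV (j + 1)).trans hab.le) _
  rw [this]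

end Martingale

/-! ### Measurability with respect to the history -/

section Noise

open scoped ENNReal

variable {Ω : Type*} {n m : ℕ}
  {φ : ℕ → Fin n → Ω → EuclideanSpace ℝ (Fin m)} {Ξ : ℕ → Ω → EuclideanSpace ℝ (Fin n)}

lemma history_mono : Monotone (history φ Ξ) := fun k l hkl => by
  refine sup_le_sup ?_ ?_ <;>
  exact biSup_mono fun j hj => Finset.Icc_subset_Icc_right hkl hj

lemma history_le [MeasurableSpace Ω] (hφ : ∀ k i, Measurable (φ k i))
    (hΞ : ∀ k, Measurable (Ξ (k + 1))) (k : ℕ) :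
    history φ Ξ k ≤ ‹MeasurableSpace Ω› := by
  refine sup_le (iSup₂_le fun j _ => iSup_le fun i => (hφ j i).comap_le)
    (iSup₂_le fun j hj => ?_)
  obtain ⟨l, rfl⟩ := Nat.exists_eq_add_of_le' (Finset.mem_Icc.1 hj).1
  exact (hΞ l).comap_le

/-- The filtration of the histories. -/
def historyFiltration [MeasurableSpace Ω] (hφ : ∀ k i, Measurable (φ k i))
    (hΞ : ∀ k, Measurable (Ξ (k + 1))) :
    Filtration ℕ ‹MeasurableSpace Ω› where
  seq := history φ Ξ
  mono' := history_mono
  le' := history_le hφ hΞ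

lemma measurable_regressor_history {j k : ℕ} (hjk : j ≤ k) (i : Fin n) :
    Measurable[history φ Ξ k] (φ j i) := by
  refine measurable_iff_comap_le.2 (le_trans ?_ le_sup_left)
  exact le_trans (le_iSup (fun i => MeasurableSpace.comap (φ j i) inferInstance) i)
    (le_biSup (fun j => ⨆ i, MeasurableSpace.comap (φ j i) inferInstance)
      (Finset.mem_Icc.2 ⟨j.zero_le, hjk⟩))

lemma measurable_noise_history (k : ℕ) : Measurable[history φ Ξ (k + 1)] (Ξ (k + 1)) := by
  refine measurable_iff_comap_le.2 (le_trans ?_ le_sup_right)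
  exact le_biSup (fun j => MeasurableSpace.comap (Ξ j) inferInstance)
    (Finset.mem_Icc.2 ⟨by omega, le_rfl⟩)

lemma measurable_r_history (k : ℕ) (i : Fin n) :
    Measurable[history φ Ξ k] fun ω => r (fun j i => φ j i ω) k i := by
  refine Measurable.add measurable_const (Finset.measurable_sum _ fun j hj => ?_)
  exact (measurable_norm.pow_const 2).comp
    (measurable_regressor_history (Finset.mem_Icc.1 hj).2 i)

lemma measurable_weight_history (δ : ℝ) (k : ℕ) (i : Fin n) (a : Fin m) :
    Measurable[history φ Ξ k] fun ω =>
      r (fun j i => φ j i ω) k i ^ (δ - 1) * φ k i ω a := by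
  refine Measurable.mul ((measurable_r_history k i).pow_const (δ - 1)) ?_
  exact (by fun_prop : Measurable fun v : EuclideanSpace ℝ (Fin m) => v a).comp
    (measurable_regressor_history le_rfl i)

end Noise

/-! ### Pathwise bound on the predictable variation -/

section Path

variable {n m : ℕ} (φ : ℕ → Fin n → EuclideanSpace ℝ (Fin m))

lemma r_le_norm_R (k : ℕ) (i : Fin n) : r φ k i ≤ ‖R φ k‖ := by
  rw [R, Matrix.l2_opNorm_diagonal]
  exact (le_abs_self _).trans (norm_le_pi_norm (r φ k) i)

lemma CondBounded.exists_norm_R_le {φ : ℕ → Fin n → EuclideanSpace ℝ (Fin m)}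
    (h : CondBounded φ) : ∃ γ : ℝ, 0 < γ ∧ ∀ k i, ‖R φ k‖ ≤ γ * r φ k i := by
  obtain ⟨γ, hγ, h⟩ := h
  refine ⟨γ, hγ, fun k i => ?_⟩
  have : Nonempty (Fin n) := ⟨i⟩
  have hinf : 1 ≤ ⨅ j, r φ k j := le_ciInf fun j => one_le_r φ k j
  have hle : (⨆ j, r φ k j) ≤ γ * r φ k i := by
    refine ((div_le_iff₀ (one_pos.trans_le hinf)).1 (h k)).trans ?_
    exact mul_le_mul_of_nonneg_left (ciInf_le (Set.finite_range _).bddBelow i) hγ.le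
  rw [R, Matrix.l2_opNorm_diagonal]
  refine (pi_norm_le_iff_of_nonneg (mul_nonneg hγ.le (r_pos φ k i).le)).2 fun j => ?_
  rw [Real.norm_of_nonneg (r_pos φ k j).le]
  exact (le_ciSup (Set.finite_range _).bddAbove j).trans hle

lemma sum_weight_sq_le {γ c₀ ε δ : ℝ} (hγ0 : 0 < γ) (hγ : ∀ k i, ‖R φ k‖ ≤ γ * r φ k i)
    (hc₀ : 0 < c₀) (hε : 0 ≤ ε) (hδ : δ < (1 - ε) / 2) (i : Fin n) (a : Fin m) (K : ℕ) :
    ∑ j ∈ Finset.range K, (r φ j i ^ (δ - 1) * φ j i a) ^ 2 * (c₀ * ‖R φ j‖ ^ ε) ≤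
      c₀ * γ ^ ε * (‖φ 0 i‖ ^ 2 + 1 / (1 - 2 * δ - ε)) := by
  have hη : 0 < 1 - 2 * δ - ε := by linarith
  refine le_trans ?_ (mul_le_mul_of_nonneg_left (sum_sq_div_r_rpow_le φ hη i K) (by positivity))
  rw [Finset.mul_sum]
  refine Finset.sum_le_sum fun j _ => ?_
  have hr := r_pos φ j i
  have h1 : ‖R φ j‖ ^ ε ≤ γ ^ ε * r φ j i ^ ε := by
    rw [← Real.mul_rpow hγ0.le hr.le]
    exact Real.rpow_le_rpow (norm_nonneg _) (hγ j i) hε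
  have h2 : φ j i a ^ 2 ≤ ‖φ j i‖ ^ 2 := by
    rw [EuclideanSpace.real_norm_sq_eq]
    exact Finset.single_le_sum (f := fun a => φ j i a ^ 2) (fun _ _ => sq_nonneg _)
      (Finset.mem_univ a)
  -- The excess `1 - 2δ - ε` over exponent `1` is positive exactly when `δ < (1-ε)/2`.
  have h3 : (r φ j i ^ (δ - 1)) ^ 2 * r φ j i ^ ε = (r φ j i ^ (1 + (1 - 2 * δ - ε)))⁻¹ := by
    rw [← Real.rpow_natCast, ← Real.rpow_mul hr.le, ← Real.rpow_add hr, ← Real.rpow_neg hr.le]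
    congr 1
    push_cast
    ring
  calc _ ≤ ((r φ j i ^ (δ - 1)) ^ 2 * ‖φ j i‖ ^ 2) * (c₀ * (γ ^ ε * r φ j i ^ ε)) := by
        rw [mul_pow]
        gcongr
    _ = c₀ * γ ^ ε * (‖φ j i‖ ^ 2 * ((r φ j i ^ (δ - 1)) ^ 2 * r φ j i ^ ε)) := by ring
    _ = _ := by rw [h3, div_eq_mul_inv]

end Path

/-! ### Almost sure boundedness of the weighted noise -/

section Noise

open scoped ENNReal

variable {Ω : Type*} [MeasurableSpace Ω] {P : Measure Ω} [IsProbabilityMeasure P] {n m : ℕ}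
  {φ : ℕ → Fin n → Ω → EuclideanSpace ℝ (Fin m)} {Ξ : ℕ → Ω → EuclideanSpace ℝ (Fin n)}
  {c₀ ε : Ω → ℝ}

/-- The weighted noise sums are almost surely bounded. -/
lemma ae_weighted_noise_bounded (hφ : ∀ k i, Measurable (φ k i))
    (hΞ : ∀ k, Measurable (Ξ (k + 1))) (hnoise : NoiseCondition P φ Ξ c₀ ε)
    (hcond : ∀ᵐ ω ∂P, CondBounded (fun k i => φ k i ω)) (δ : ℝ) (i : Fin n) (a : Fin m) :
    ∀ᵐ ω ∂P, δ < (1 - ε ω) / 2 → ∃ B, ∀ k, |∑ j ∈ Finset.range k,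
      r (fun k i => φ k i ω) j i ^ (δ - 1) * φ j i ω a * Ξ (j + 1) ω i| ≤ B := by
  let ℱ := historyFiltration hφ hΞ
  let pr : EuclideanSpace ℝ (Fin n) →L[ℝ] ℝ := EuclideanSpace.proj i
  have hX : ∀ k, Measurable[ℱ (k + 1)] fun ω => Ξ (k + 1) ω i := fun k =>
    pr.continuous.measurable.comp (measurable_noise_history k)
  have hXint : ∀ k, Integrable (fun ω => Ξ (k + 1) ω i) P := fun k =>
    pr.integrable_comp (hnoise.integrable k)
  have hX0 : ∀ k, P[fun ω => Ξ (k + 1) ω i | ℱ k] =ᵐ[P] 0 := fun k => by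
    filter_upwards [pr.comp_condExp_comm (m := history φ Ξ k) (hnoise.integrable k),
      hnoise.condExp_zero k] with ω h1 h2
    refine h1.symm.trans ?_
    rw [Function.comp_apply, h2]
    simp
  have hconv := ae_tendsto_of_condVar (ℱ := ℱ) (P := P) (X := fun k ω => Ξ k ω i)
    (w := fun k ω => r (fun j i => φ j i ω) k i ^ (δ - 1) * φ k i ω a) hX hXint hX0
    fun k => measurable_weight_history δ k i a
  have hmono : ∀ᵐ ω ∂P, ∀ k, condLExp (history φ Ξ k) P (fun ω' => ‖Ξ (k + 1) ω' i‖ₑ ^ 2) ω ≤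
      condLExp (history φ Ξ k) P (fun ω' => ‖Ξ (k + 1) ω'‖ₑ ^ 2) ω :=
    ae_all_iff.2 fun k => condLExp_mono (ae_of_all _ fun ω' =>
      pow_le_pow_left' (enorm_le_iff_norm_le.2 (PiLp.norm_apply_le (Ξ (k + 1) ω') i)) 2)
  filter_upwards [hconv, hmono, ae_all_iff.2 hnoise.condVar_le, hnoise.constants, hcond]
    with ω h1 h2 h3 h4 h5 hδ
  obtain ⟨γ, hγ0, hγ⟩ := h5.exists_norm_R_le
  obtain ⟨c, hc⟩ := h1 ⟨_, ENNReal.ofReal_ne_top, fun K => by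
    refine le_trans ?_ (ENNReal.ofReal_le_ofReal
      (sum_weight_sq_le (fun k i => φ k i ω) hγ0 hγ h4.1 h4.2.1 hδ i a K))
    rw [ENNReal.ofReal_sum_of_nonneg fun j _ => mul_nonneg (sq_nonneg _)
      (mul_nonneg h4.1.le (Real.rpow_nonneg (norm_nonneg _) _))]
    refine Finset.sum_le_sum fun j _ => ?_
    rw [ENNReal.ofReal_mul (sq_nonneg _), ← enorm_pow, Real.enorm_of_nonneg (sq_nonneg _)]
    exact mul_le_mul' le_rfl ((h2 j).trans (h3 j))⟩
  obtain ⟨B, hB⟩ := hc.abs.bddAbove_range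
  exact ⟨B, fun k => hB ⟨k, rfl⟩⟩

end Noise

end DistSG

/-! ### Almost sure rate, uniformly in `δ` -/

theorem mainTheorem5 {Ω : Type*} [MeasurableSpace Ω] (P : Measure Ω) [IsProbabilityMeasure P]
    {n m : ℕ} (hm : 1 ≤ m)
    -- the network, which is connected, and the parameters of the algorithm
    (𝒩 : DistSG.Network n) (hconn : 𝒩.graph.Connected)
    (Q : ℕ) (hQ : 𝒩.graph.diam ≤ Q)
    (μ ν : ℝ) (hμ : μ ∈ Set.Ioo (0 : ℝ) 1) (hν : ν ∈ Set.Ioo (0 : ℝ) 1)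
    (hμν : μ * (1 + 4 * ν) < 1)
    -- the regression model `y^i_{k+1} = θᵀ φ^i_k + ε^i_{k+1}`, where `Ξ k = (ε^1_k, …, ε^n_k)`
    (θ : EuclideanSpace ℝ (Fin m))
    (φ : ℕ → Fin n → Ω → EuclideanSpace ℝ (Fin m)) (hφ : ∀ k i, Measurable (φ k i))
    (Ξ : ℕ → Ω → EuclideanSpace ℝ (Fin n)) (hΞ : ∀ k, Measurable (Ξ (k + 1)))
    (y : ℕ → Fin n → Ω → ℝ)
    (hy : ∀ k i ω, y (k + 1) i ω = inner ℝ θ (φ k i ω) + Ξ (k + 1) ω i)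
    (c₀ ε : Ω → ℝ) (hnoise : DistSG.NoiseCondition P φ Ξ c₀ ε)
    (hcond : ∀ᵐ ω ∂P, DistSG.CondBounded (fun k i => φ k i ω))
    -- arbitrary (possibly random) initial estimates
    (θ₀ : Fin n → Ω → EuclideanSpace ℝ (Fin m)) :
    -- `τ₁ = mn` is admissible
    (∀ ω, DistSG.DetBound 𝒩 (fun k i => φ k i ω) Q μ ν ((m : ℝ) * n)) ∧
    -- the rate holds for every admissible `τ₁`; nonsingularity of `I - μ G_0` is automatic if
    -- `‖φ^i_0‖ ≤ 1` for all `i`, and only matters since `r^i_0 = 1` does not involve `φ^i_0`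
    ∀ᵐ ω ∂P,
      (1 - μ • DistSG.G 𝒩 (fun k i => φ k i ω) Q ν 0).det ≠ 0 →
      Tendsto (fun k => DistSG.Psi 𝒩 (fun k i => φ k i ω) Q μ ν k) atTop (𝓝 0) →
      ∀ δ ∈ Set.Ioo (0 : ℝ) ((1 - ε ω) / 2), ∀ τ₁ : ℝ, 1 ≤ τ₁ →
        DistSG.DetBound 𝒩 (fun k i => φ k i ω) Q μ ν τ₁ →
        ∃ M : ℝ, 0 < M ∧ ∀ k : ℕ,
          ‖DistSG.stack (DistSG.estimate 𝒩 (fun k i => φ k i ω) Q μ ν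
              (fun k i => y k i ω) (fun i => θ₀ i ω) k) - DistSG.stack (fun _ => θ)‖
            ≤ M * ‖DistSG.Psi 𝒩 (fun k i => φ k i ω) Q μ ν k‖ ^ (δ / (n * τ₁ * (1 + δ))) := by
  have hμν' := hμν.le
  have hn : 0 < n := by
    obtain ⟨i⟩ := hconn.nonempty
    exact i.pos
  refine ⟨fun ω => DistSG.detBound_mul 𝒩 _ hμ.1.le hν.1.le hμν', ?_⟩
  -- The null set depends on the exponent, so only rational exponents are treated; any real `δ` is
  -- then replaced by a larger rational `q`.
  have hB : ∀ᵐ ω ∂P, ∀ (q : ℚ) (i : Fin n) (a : Fin m), (q : ℝ) < (1 - ε ω) / 2 →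
      ∃ B, ∀ k, |∑ j ∈ Finset.range k, DistSG.r (fun k i => φ k i ω) j i ^ ((q : ℝ) - 1) *
        φ j i ω a * Ξ (j + 1) ω i| ≤ B :=
    ae_all_iff.2 fun q => ae_all_iff.2 fun i => ae_all_iff.2 fun a =>
      DistSG.ae_weighted_noise_bounded hφ hΞ hnoise hcond q i a
  filter_upwards [hB, hcond] with ω hB hcond h0 _ δ hδ τ hτ hdet
  obtain ⟨q, hδq, hq⟩ := exists_rat_btwn hδ.2
  choose B hB using fun i a => hB q i a hq
  obtain ⟨γ, -, hγ⟩ := hcond.exists_norm_R_le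
  have hle : ∀ i a k, |∑ j ∈ Finset.range k, DistSG.r (fun k i => φ k i ω) j i ^ ((q : ℝ) - 1) *
      φ j i ω a * Ξ (j + 1) ω i| ≤ ∑ p : Fin n × Fin m, |B p.1 p.2| := fun i a k =>
    ((hB i a k).trans (le_abs_self _)).trans (Finset.single_le_sum
      (f := fun p : Fin n × Fin m => |B p.1 p.2|) (fun _ _ => abs_nonneg _)
      (Finset.mem_univ (i, a)))
  have hq0 : 0 < (q : ℝ) := hδ.1.trans hδq
  obtain ⟨M, hM, hMle⟩ := DistSG.exists_error_le 𝒩 (fun k i => φ k i ω) hn hμ.1.le hν.1.le hμν'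
    h0 hdet hτ (DistSG.r_le_norm_R _) hγ θ (fun k i => y k i ω) (fun k i => Ξ k ω i)
    (fun k i => hy k i ω) (fun i => θ₀ i ω) hq0 hle
  obtain ⟨C, hC1, hC⟩ := DistSG.exists_norm_Psi_le 𝒩 (fun k i => φ k i ω) (Q := Q) hμ.1.le hν.1.le
    hμν'
  have hn0 : (0 : ℝ) < n := by exact_mod_cast hn
  have hδ0 := hδ.1
  set s := δ / (n * τ * (1 + δ)) with hs
  set s' := (q : ℝ) / (n * τ * (1 + q)) with hs'
  have hτ0 : 0 < τ := one_pos.trans_le hτ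
  have hs0 : 0 ≤ s := by positivity
  -- `t ↦ t/(1+t)` is increasing, so `q` gives the better exponent; boundedness of `Ψ` absorbs the
  -- surplus power `s' - s`.
  have hss : s ≤ s' := by
    rw [hs, hs', div_le_div_iff₀ (by positivity) (by positivity)]
    have : 0 < n * τ := by positivity
    nlinarith
  refine ⟨M * C ^ (s' - s), by positivity, fun k => (hMle k).trans ?_⟩
  rw [mul_assoc]
  refine mul_le_mul_of_nonneg_left ?_ hM.le
  have hp := norm_nonneg (DistSG.Psi 𝒩 (fun k i => φ k i ω) Q μ ν k)
  calc _ = ‖DistSG.Psi 𝒩 (fun k i => φ k i ω) Q μ ν k‖ ^ (s' - s) *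
        ‖DistSG.Psi 𝒩 (fun k i => φ k i ω) Q μ ν k‖ ^ s := by
        rw [← Real.rpow_add_of_nonneg hp (sub_nonneg.2 hss) hs0, sub_add_cancel]
    _ ≤ _ := mul_le_mul_of_nonneg_right
      (Real.rpow_le_rpow hp (hC k) (sub_nonneg.2 hss)) (Real.rpow_nonneg hp s)
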